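/- Let $\mathbb T$ be the unit circle with normalized Lebesgue measure $\ell$, let $I\subset\mathbb T$ be a finite union of closed arcs and $J=\mathbb T\setminus I$, with $\ell(I)>0$ and $\ell(J)>0$. Let $H^2$ be the space of functions in $L^2(\mathbb T)$ whose Fourier coefficients of strictly negative index vanish, and for $n\ge 0$ let $T_n$ be the space of polynomials $q(e^{i\theta})$ in $e^{i\theta}$ of degree at most $n$ with complex coefficients. Let $f\in L^2(I)$. Let $g_0$ be the solution of the bounded extremal problem $BEP_{2,\infty}$: $g_0\in H^2$, $|g_0|\le 1$ a.e. on $J$, and $$\|f-g_0\|_{L^2(I)}=\min\{\|f-g\|_{L^2(I)} : g\in H^2,\ |g|\le 1\text{ a.e. on }J\}.$$ For each $n\geq 0$ let $k_n$ be the solution of its polynomial version $FBEP^n_{2,\infty}$: $k_n\in T_n$, $|k_n|\le 1$ a.e. on $J$, and $$\|f-k_n\|_{L^2(I)}=\min\{\|f-g\|_{L^2(I)} : g\in T_n,\ |g|\le 1\text{ a.e. on }J\}.$$ (a) As $n\to\infty$, $\|g_0-k_n\|_{L^2(I)}\to 0$, and $k_n\to g_0$ weak-* in $L^\infty(J)$,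 that is, $$\lim_{n\to\infty}\frac1{2\pi}\int_J k_n(e^{i\theta})\,\overline{h(e^{i\theta})}\,d\theta=\frac1{2\pi}\int_J g_0(e^{i\theta})\,\overline{h(e^{i\theta})}\,d\theta\qquad\text{for every } h\in L^1(J).$$ (b) Assume moreover that every $g\in H^2$ such that $|g|\le1$ a.e. on $J$ and $g=f$ a.e. on $I$ satisfies $|g|=1$ a.e. on $J$ (this holds in particular if $f$ is not the trace on $I$ of any $g\in H^2$ with $|g|\le 1$ a.e. on $J$). Then $$\lim_{n\to\infty}\|g_0-k_n\|_{L^2(\mathbb T)}=0\qquad\text{and}\qquad \lim_{n\to\infty}\|g_0-k_n\|_{L^p(J)}=0\quad\text{for every }1\le p<\infty.$$ -/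

import Mathlib

open Filter Topology MeasureTheory AddCircle
open scoped Real ENNReal

/-- The unit circle, parametrized by the angle `θ` modulo `2π`; the point `e^{iθ}` is
`fourier 1 θ`. Its normalized Lebesgue measure is Mathlib's `haarAddCircle`. -/
abbrev UnitTorus : Type := AddCircle (2 * π)

instance unitTorusFact : Fact (0 < 2 * π) := ⟨Real.two_pi_pos⟩

namespace BoundedExtremal

/-- Normalized Lebesgue measure on the circle. -/
noncomputable def ell : Measure UnitTorus := haarAddCircle

/-- The norm `‖h‖_{L^p(E)}`, with values in `[0, ∞]`. -/
noncomputable def lpNormOn (p : ℝ≥0∞) (E : Set UnitTorus) (h : UnitTorus → ℂ) : ℝ≥0∞ :=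
  eLpNorm h p (ell.restrict E)

/-- `h ∈ L^p(E)`. -/
def MemLpOn (p : ℝ≥0∞) (E : Set UnitTorus) (h : UnitTorus → ℂ) : Prop :=
  MemLp h p (ell.restrict E)

/-- The Hardy space `H^p`: functions in `L^p` of the circle whose Fourier coefficients of
strictly negative index vanish. -/
def MemHardy (p : ℝ≥0∞) (g : UnitTorus → ℂ) : Prop :=
  MemLp g p ell ∧ ∀ n : ℤ, n < 0 → fourierCoeff g n = 0

/-- The duality product `⟨u, v⟩_E = (1 / 2π) ∫_E u(e^{iθ}) conj(v(e^{iθ})) dθ`. -/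
noncomputable def pairingOn (E : Set UnitTorus) (u v : UnitTorus → ℂ) : ℂ :=
  ∫ x in E, u x * (starRingEnd ℂ) (v x) ∂ell

/-- The function `θ ↦ q(e^{iθ})` on the circle defined by a polynomial `q`. -/
noncomputable def polyTrace (q : Polynomial ℂ) : UnitTorus → ℂ :=
  fun x => q.eval (fourier 1 x : ℂ)

/-- `|g| ≤ 1` almost everywhere on `E`. -/
def BoundedByOneOn (E : Set UnitTorus) (g : UnitTorus → ℂ) : Prop :=
  ∀ᵐ x ∂(ell.restrict E), ‖g x‖ ≤ 1

/-- `I` is a finite union of closed arcs `{e^{iθ} : a j ≤ θ ≤ b j}`. -/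
def IsFiniteUnionOfClosedArcs (I : Set UnitTorus) : Prop :=
  ∃ (N : ℕ) (a b : Fin N → ℝ),
    I = ⋃ j, (fun θ : ℝ => (θ : UnitTorus)) '' Set.Icc (a j) (b j)

/-- `g₀` solves the bounded extremal problem: it is a best approximation of `f` in `L²(I)` among
all `g ∈ H²` such that `|g| ≤ 1` a.e. on the complement `J` of `I`. -/
def IsBEPSolution (I : Set UnitTorus) (f g₀ : UnitTorus → ℂ) : Prop :=
  MemHardy 2 g₀ ∧ BoundedByOneOn Iᶜ g₀ ∧
    ∀ g : UnitTorus → ℂ, MemHardy 2 g → BoundedByOneOn Iᶜ g →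
      lpNormOn 2 I (fun x => f x - g₀ x) ≤ lpNormOn 2 I (fun x => f x - g x)

/-- `k` solves the polynomial bounded extremal problem of degree `n`: it is a best approximation
of `f` in `L²(I)` among all polynomials of degree at most `n` such that `|g| ≤ 1` a.e. on the
complement `J` of `I`. -/
def IsFBEPSolution (I : Set UnitTorus) (f : UnitTorus → ℂ) (n : ℕ) (k : Polynomial ℂ) : Prop :=
  k.natDegree ≤ n ∧ BoundedByOneOn Iᶜ (polyTrace k) ∧
    ∀ q : Polynomial ℂ, q.natDegree ≤ n → BoundedByOneOn Iᶜ (polyTrace q) →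
      lpNormOn 2 I (fun x => f x - polyTrace k x) ≤ lpNormOn 2 I (fun x => f x - polyTrace q x)

end BoundedExtremal

namespace BoundedExtremal

/-! Convergence on `I`. Polynomials bounded by one on `J` are dense, in `L²` of the circle, among
the admissible functions (`MemHardy.exists_polynomial_bounded`), so the polynomial minima tend to
the full minimum. The constraint is convex, hence the midpoint of `g₀` and `k n` is admissible, and
the parallelogram law turns convergence of the values into convergence of `k n` to `g₀` in `L²(I)`.

Weak-* convergence. The differences `d = g₀ - k n` are bounded in `L¹` and tend to zero in `L¹(I)`.
If `h` in `H²` has real part `1_I`, the mean of `d * exp (c * h)` is the mean of `d` times `exp (c *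
ℓ(I))`, whereas the weight `exp (c * h)` is large only on `I`. Letting `c` be large and then `n`
large kills the mean, and backward shifts kill every Fourier coefficient
(`tendsto_fourierCoeff_of_tendsto_zero_on`). With the uniform bound on `J`, density of trigonometric
polynomials in `L¹` concludes.

Norm convergence. If `|g₀| = 1` on `J`, the bound `|k n| ≤ 1` upgrades weak to strong convergence
(`tendsto_lpNormOn_of_saturated`). Saturation comes from `ae_eq_of_not_saturated`: an unsaturated
solution interpolates `f`, which the assumption of part (b) excludes. For that lemma, membership in
`H²` is penalized. The penalized solutions `c n` tend to `g₀`, and their optimality condition splits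
the residual as `r n + u n`, with `r n` orthogonal to `H²` and `u n` normal to the constraint, thus
zero on `I`. The `u n` are bounded in `L¹` and small in `L¹` on a set where `|g₀| ≤ 1 - η`, so the
same uniqueness principle, applied to the conjugates of `r n`, makes `r n` tend weakly to zero. On
`I`, however, `r n = f - c n` tends to `f - g₀`. -/

instance : IsProbabilityMeasure ell := inferInstanceAs (IsProbabilityMeasure haarAddCircle)

instance : Measure.IsAddHaarMeasure ell :=
  inferInstanceAs (Measure.IsAddHaarMeasure haarAddCircle)

/-! ### Fourier coefficients and Parseval's identity on the circle. -/

lemma norm_fourier_apply (n : ℤ) (x : UnitTorus) : ‖(fourier n x : ℂ)‖ = 1 := by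
  rw [fourier_apply, Circle.norm_coe]

lemma fourierCoeff_eq_integral (g : UnitTorus → ℂ) (n : ℤ) :
    fourierCoeff g n = ∫ x, fourier (-n) x * g x ∂ell := rfl

lemma fourierCoeff_zero_eq_integral (g : UnitTorus → ℂ) :
    fourierCoeff g 0 = ∫ x, g x ∂ell := by
  simp [fourierCoeff_eq_integral]

lemma norm_fourierCoeff_le (g : UnitTorus → ℂ) (n : ℤ) :
    ‖fourierCoeff g n‖ ≤ ∫ x, ‖g x‖ ∂ell := by
  rw [fourierCoeff_eq_integral]
  refine (norm_integral_le_integral_norm _).trans_eq ?_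
  simp [norm_fourier_apply, -fourier_apply]

lemma fourierCoeff_fourier_mul (g : UnitTorus → ℂ) (m n : ℤ) :
    fourierCoeff (fun x => fourier m x * g x) n = fourierCoeff g (n - m) := by
  rw [fourierCoeff_eq_integral, fourierCoeff_eq_integral]
  congr 1; ext x
  rw [← mul_assoc, ← fourier_add]; congr 3; ring

lemma fourierCoeff_conj (g : UnitTorus → ℂ) (n : ℤ) :
    fourierCoeff (fun x => (starRingEnd ℂ) (g x)) n = (starRingEnd ℂ) (fourierCoeff g (-n)) := by
  rw [fourierCoeff_eq_integral, fourierCoeff_eq_integral, ← integral_conj]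
  congr 1; ext x
  simp only [map_mul, neg_neg, fourier_neg]

lemma fourierCoeff_fun_sub {g h : UnitTorus → ℂ} (hg : Integrable g ell) (hh : Integrable h ell)
    (n : ℤ) : fourierCoeff (fun x => g x - h x) n = fourierCoeff g n - fourierCoeff h n := by
  have := integral_sub (μ := ell) (hg.fourier_smul (-n)) (hh.fourier_smul (-n))
  rw [fourierCoeff_eq_integral, fourierCoeff_eq_integral, fourierCoeff_eq_integral]
  simp only [mul_sub]
  exact this

lemma fourierCoeff_fun_add {g h : UnitTorus → ℂ} (hg : Integrable g ell) (hh : Integrable h ell)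
    (n : ℤ) : fourierCoeff (fun x => g x + h x) n = fourierCoeff g n + fourierCoeff h n := by
  exact congrFun (fourierCoeff.add (f := g) (g := h) hg hh) n

lemma fourierCoeff_congr_ell {g h : UnitTorus → ℂ} (e : g =ᵐ[ell] h) (n : ℤ) :
    fourierCoeff g n = fourierCoeff h n := congrFun (fourierCoeff_congr_ae e) n

lemma toReal_eLpNorm_two_sq {α : Type*} [MeasurableSpace α] {μ : Measure α} {g : α → ℂ}
    (hg : MemLp g 2 μ) : (eLpNorm g 2 μ).toReal ^ 2 = ∫ x, ‖g x‖ ^ 2 ∂μ := by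
  rw [← Lp.norm_toLp g hg, ← real_inner_self_eq_norm_sq, L2.inner_def]
  refine integral_congr_ae ?_
  filter_upwards [hg.coeFn_toLp] with x hx
  rw [hx, real_inner_self_eq_norm_sq]

lemma hasSum_sq_norm_fourierCoeff {g : UnitTorus → ℂ} (hg : MemLp g 2 ell) :
    HasSum (fun n => ‖fourierCoeff g n‖ ^ 2) ((eLpNorm g 2 ell).toReal ^ 2) := by
  have h := hasSum_sq_fourierCoeff (hg.toLp g : Lp ℂ 2 (haarAddCircle (T := 2 * π)))
  have e : (hg.toLp g : UnitTorus → ℂ) =ᵐ[ell] g := hg.coeFn_toLp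
  have e2 : fourierCoeff (hg.toLp g : UnitTorus → ℂ) = fourierCoeff g := fourierCoeff_congr_ae e
  have e3 : ∫ t, ‖(hg.toLp g : UnitTorus → ℂ) t‖ ^ 2 ∂ell = (eLpNorm g 2 ell).toReal ^ 2 := by
    rw [toReal_eLpNorm_two_sq hg]
    refine integral_congr_ae ?_
    filter_upwards [e] with x hx
    rw [hx]
  rw [← e3, ← e2]
  exact h

/-- The monomials `fourier n` as a Hilbert basis of `L²` of the circle. -/
noncomputable def ellBasis : HilbertBasis ℤ ℂ (Lp ℂ 2 ell) := fourierBasis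

lemma ellBasis_repr (g : Lp ℂ 2 ell) (n : ℤ) : ellBasis.repr g n = fourierCoeff g n :=
  fourierBasis_repr g n

lemma hasSum_conj_fourierCoeff_mul {u g : UnitTorus → ℂ} (hu : MemLp u 2 ell)
    (hg : MemLp g 2 ell) :
    HasSum (fun n => (starRingEnd ℂ) (fourierCoeff u n) * fourierCoeff g n)
      (∫ x, (starRingEnd ℂ) (u x) * g x ∂ell) := by
  have h := ellBasis.hasSum_inner_mul_inner (hu.toLp u) (hg.toLp g)
  have e1 : (hu.toLp u : UnitTorus → ℂ) =ᵐ[ell] u := hu.coeFn_toLp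
  have e2 : (hg.toLp g : UnitTorus → ℂ) =ᵐ[ell] g := hg.coeFn_toLp
  have key : inner ℂ (hu.toLp u) (hg.toLp g) = ∫ x, (starRingEnd ℂ) (u x) * g x ∂ell := by
    rw [L2.inner_def]
    refine integral_congr_ae ?_
    filter_upwards [e1, e2] with x h1 h2
    rw [h1, h2, RCLike.inner_apply']
  have k1 : ∀ n, inner ℂ (hu.toLp u) (ellBasis n) = (starRingEnd ℂ) (fourierCoeff u n) := by
    intro n
    rw [← inner_conj_symm, ← ellBasis.repr_apply_apply, ellBasis_repr,
      fourierCoeff_congr_ell e1]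
  have k2 : ∀ n, inner ℂ (ellBasis n) (hg.toLp g) = fourierCoeff g n := by
    intro n
    rw [← ellBasis.repr_apply_apply, ellBasis_repr, fourierCoeff_congr_ell e2]
  simp only [k1, k2] at h
  rwa [← key]

lemma ae_eq_zero_of_fourierCoeff_eq_zero {g : UnitTorus → ℂ} (hg : MemLp g 2 ell)
    (h : ∀ n, fourierCoeff g n = 0) : g =ᵐ[ell] 0 := by
  have := hasSum_sq_norm_fourierCoeff hg
  simp only [h, norm_zero, ne_eq, OfNat.ofNat_ne_zero, not_false_eq_true, zero_pow] at this
  have h0 : (eLpNorm g 2 ell).toReal ^ 2 = 0 := this.unique hasSum_zero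
  have h1 : eLpNorm g 2 ell = 0 := by
    rcases (ENNReal.toReal_eq_zero_iff _).1 (pow_eq_zero_iff two_ne_zero |>.1 h0) with h | h
    · exact h
    · exact absurd h hg.2.ne
  exact (eLpNorm_eq_zero_iff hg.1 two_ne_zero).1 h1

/-! ### Polynomials on the circle -/

lemma fourier_one_pow (n : ℕ) (x : UnitTorus) : (fourier 1 x : ℂ) ^ n = fourier (n : ℤ) x := by
  induction n with
  | zero => simp
  | succ k ih => rw [pow_succ, ih, ← fourier_add]; push_cast; rfl

lemma continuous_polyTrace (q : Polynomial ℂ) : Continuous (polyTrace q) :=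
  q.continuous.comp (map_continuous (fourier 1))

lemma memLp_of_continuous {u : UnitTorus → ℂ} (hu : Continuous u) (p : ℝ≥0∞) : MemLp u p ell := by
  exact MemLp.of_bound hu.aestronglyMeasurable ‖(BoundedContinuousFunction.mkOfCompact ⟨u, hu⟩)‖
    (ae_of_all _ fun x => (BoundedContinuousFunction.mkOfCompact ⟨u, hu⟩).norm_coe_le_norm x)

lemma polyTrace_eq_sum {q : Polynomial ℂ} {N : ℕ} (hN : q.natDegree < N) :
    polyTrace q = ∑ i ∈ Finset.range N, fun x => q.coeff i * (fourier (i : ℤ) x : ℂ) := by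
  ext x
  simp [polyTrace, Polynomial.eval_eq_sum_range' hN, fourier_one_pow, -fourier_apply]

lemma fourierCoeff_polyTrace (q : Polynomial ℂ) (n : ℤ) :
    fourierCoeff (polyTrace q) n = if 0 ≤ n then q.coeff n.toNat else 0 := by
  -- The truncation exceeds both the degree and `n`, so the index `n.toNat` is always in the sum.
  rw [polyTrace_eq_sum (q := q) (N := q.natDegree + 1 + n.toNat) (by omega), fourierCoeff.sum]
  · rw [Finset.sum_apply]
    simp only [fourierCoeff.const_mul, fourierCoeff_fourier]
    split_ifs with h
    · rw [Finset.sum_eq_single n.toNat]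
      · simp [h]
      · intro b _ hb
        rw [Pi.single_eq_of_ne (by omega), mul_zero]
      · intro hh; simp at hh
    · refine Finset.sum_eq_zero fun i _ => ?_
      rw [Pi.single_eq_of_ne (by omega), mul_zero]
  · intro i _
    exact memLp_one_iff_integrable.1 (memLp_of_continuous (by fun_prop) 1)

lemma memHardy_polyTrace (q : Polynomial ℂ) (p : ℝ≥0∞) : MemHardy p (polyTrace q) :=
  ⟨memLp_of_continuous (continuous_polyTrace q) p, fun n hn => by
    rw [fourierCoeff_polyTrace, if_neg (by omega)]⟩

/-! ### Averages over arcs and approximation by polynomials -/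

/-- The average of the monomial `fourier n` over the arc of radius `r` centered at `0`. -/
noncomputable def arcMultiplier (r : ℝ) (n : ℤ) : ℂ :=
  ⨍ y in Metric.ball (0 : UnitTorus) r, (fourier n y : ℂ) ∂ell

/-- Averages stay in closed convex sets. The unit disc gives the bound by one, small discs about `1`
give the limit as the radius shrinks. -/
lemma arcMultiplier_mem {r : ℝ} (hr : 0 < r) {n : ℤ} {s : Set ℂ} (hs : Convex ℝ s)
    (hc : IsClosed s) (h : ∀ y ∈ Metric.ball (0 : UnitTorus) r, (fourier n y : ℂ) ∈ s) :
    arcMultiplier r n ∈ s :=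
  hs.set_average_mem hc (Metric.measure_ball_pos ell 0 hr).ne' (measure_ne_top _ _)
    (ae_restrict_of_forall_mem Metric.isOpen_ball.measurableSet h)
    (memLp_one_iff_integrable.1 (memLp_of_continuous (map_continuous (fourier n)) 1)).integrableOn

lemma norm_arcMultiplier_le {r : ℝ} (hr : 0 < r) (n : ℤ) : ‖arcMultiplier r n‖ ≤ 1 := by
  have := arcMultiplier_mem hr (n := n) (convex_closedBall (0 : ℂ) 1) Metric.isClosed_closedBall
    (fun y _ => by simp [norm_fourier_apply, -fourier_apply])
  simpa using this

lemma tendsto_arcMultiplier (n : ℤ) :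
    Tendsto (fun k : ℕ => arcMultiplier (1 / ((k : ℝ) + 1)) n) atTop (𝓝 1) := by
  rw [Metric.tendsto_atTop]
  intro ε hε
  have hc : ContinuousAt (fun y => (fourier n y : ℂ)) (0 : UnitTorus) :=
    (map_continuous (fourier n)).continuousAt
  obtain ⟨δ, hδ, H⟩ := Metric.continuousAt_iff.1 hc (ε / 2) (by positivity)
  obtain ⟨K, hK⟩ := exists_nat_one_div_lt hδ
  refine ⟨K, fun k hk => ?_⟩
  have hle : 1 / ((k : ℝ) + 1) ≤ 1 / ((K : ℝ) + 1) := by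
    have : (K : ℝ) ≤ k := by exact_mod_cast hk
    exact one_div_le_one_div_of_le (by positivity) (by linarith)
  have := arcMultiplier_mem (r := 1 / ((k : ℝ) + 1)) (by positivity) (n := n)
    (convex_closedBall (1 : ℂ) (ε / 2)) Metric.isClosed_closedBall (fun y hy => by
      have := H (x := y) (lt_of_lt_of_le (Metric.mem_ball.1 hy) (hle.trans hK.le))
      rw [fourier_eval_zero] at this
      exact this.le)
  exact lt_of_le_of_lt (Metric.mem_closedBall.1 this) (by linarith)

lemma setIntegral_ball_add (u : UnitTorus → ℂ) (x : UnitTorus) (r : ℝ) :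
    ∫ y in Metric.ball x r, u y ∂ell = ∫ y in Metric.ball 0 r, u (x + y) ∂ell := by
  rw [← integral_indicator Metric.isOpen_ball.measurableSet,
    ← integral_indicator Metric.isOpen_ball.measurableSet,
    ← integral_add_left_eq_self _ x]
  congr 1; ext y
  simp only [Set.indicator, Metric.mem_ball, dist_eq_norm, add_sub_cancel_left, sub_zero]

lemma measureReal_ball_eq (x : UnitTorus) (r : ℝ) :
    ell.real (Metric.ball x r) = ell.real (Metric.ball 0 r) := by
  rw [measureReal_def, measureReal_def, ← measure_preimage_add ell x (Metric.ball x r)]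
  congr 2; ext y
  simp [dist_eq_norm]

/-- The average is the inner product of `g` with a normalized indicator, so Parseval's identity
applies. The series therefore converges at every point, unlike that of `g` itself. -/
lemma hasSum_setAverage_ball {g : UnitTorus → ℂ} (hg : MemLp g 2 ell) (x : UnitTorus) (r : ℝ) :
    HasSum (fun n => fourierCoeff g n * arcMultiplier r n * fourier n x)
      (⨍ y in Metric.ball x r, g y ∂ell) := by
  have hu : MemLp ((Metric.ball x r).indicator fun _ => (1 : ℂ)) 2 ell :=
    memLp_indicator_const 2 Metric.isOpen_ball.measurableSet 1 (Or.inr (measure_ne_top _ _))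
  have h := (hasSum_conj_fourierCoeff_mul hu hg).const_smul (ell.real (Metric.ball x r))⁻¹
  have e : ∫ y, (starRingEnd ℂ) ((Metric.ball x r).indicator (fun _ => (1 : ℂ)) y) * g y ∂ell
      = ∫ y in Metric.ball x r, g y ∂ell := by
    rw [← integral_indicator Metric.isOpen_ball.measurableSet]
    congr 1; ext y
    by_cases hy : y ∈ Metric.ball x r <;> simp [Set.indicator, hy]
  rw [e, ← setAverage_eq] at h
  refine h.congr_fun ?_
  intro n
  have e2 : fourierCoeff ((Metric.ball x r).indicator fun _ => (1 : ℂ)) n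
      = ∫ y in Metric.ball x r, (fourier (-n) y : ℂ) ∂ell := by
    rw [fourierCoeff_eq_integral, ← integral_indicator Metric.isOpen_ball.measurableSet]
    congr 1; ext y
    by_cases hy : y ∈ Metric.ball x r <;> simp [Set.indicator, hy, -fourier_apply]
  rw [e2, ← integral_conj, arcMultiplier, setAverage_eq, measureReal_ball_eq x r]
  simp only [fourier_neg, Complex.conj_conj]
  rw [setIntegral_ball_add (fun y => (fourier n y : ℂ)) x r]
  simp only [fourier_apply, smul_add, toCircle_add, Circle.coe_mul]
  rw [integral_const_mul]
  simp only [Complex.real_smul]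
  ring

/-- A function in `H²` is the limit in `L²` of polynomials that are uniformly close to averages of
the function over shrinking arcs. -/
theorem MemHardy.exists_polynomial_seq {g : UnitTorus → ℂ} (hg : MemHardy 2 g) :
    ∃ p : ℕ → Polynomial ℂ,
      Tendsto (fun k => eLpNorm (fun x => polyTrace (p k) x - g x) 2 ell) atTop (𝓝 0) ∧
      ∀ (k : ℕ) (x : UnitTorus),
        ‖polyTrace (p k) x - ⨍ y in Metric.ball x (1 / ((k : ℝ) + 1)), g y ∂ell‖
          ≤ 1 / ((k : ℝ) + 1) := by
  have hr : ∀ k : ℕ, (0 : ℝ) < 1 / ((k : ℝ) + 1) := fun k => by positivity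
  let c : ℕ → ℕ → ℂ := fun k n => fourierCoeff g n * arcMultiplier (1 / ((k : ℝ) + 1)) n
  have hsum : ∀ (k : ℕ) (x : UnitTorus), HasSum (fun n : ℕ => c k n * (fourier (n : ℤ) x : ℂ))
      (⨍ y in Metric.ball x (1 / ((k : ℝ) + 1)), g y ∂ell) := by
    intro k x
    have h := hasSum_setAverage_ball hg.1 x (1 / ((k : ℝ) + 1))
    have := (Nat.cast_injective (R := ℤ)).hasSum_iff (f := fun n =>
      fourierCoeff g n * arcMultiplier (1 / ((k : ℝ) + 1)) n * (fourier n x : ℂ)) (a :=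
      ⨍ y in Metric.ball x (1 / ((k : ℝ) + 1)), g y ∂ell) (by
        intro n hn
        have : n < 0 := by
          by_contra h'
          exact hn ⟨n.toNat, by simp; omega⟩
        rw [hg.2 n this]; simp)
    exact this.2 h
  -- In `ℂ` summability is absolute, and the monomials have modulus one; a single point therefore
  -- controls the series uniformly.
  have hsn : ∀ k, Summable fun n => ‖c k n‖ := by
    intro k
    have := (hsum k 0).summable.norm
    simpa [norm_fourier_apply, -fourier_apply] using this
  -- The tail bound gives the uniform estimate; `k ≤ N k` ensures that each fixed coefficient is
  -- eventually kept, as convergence in `L²` requires.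
  have hN : ∀ k : ℕ, ∃ N : ℕ, k ≤ N ∧ ∑' n, ‖c k (n + N)‖ < 1 / ((k : ℝ) + 1) := by
    intro k
    have := tendsto_sum_nat_add fun n => ‖c k n‖
    exact ((eventually_ge_atTop k).and (this.eventually (gt_mem_nhds (hr k)))).exists
  choose N hkN hN using hN
  let p : ℕ → Polynomial ℂ := fun k =>
    ∑ n ∈ Finset.range (N k), Polynomial.monomial n (c k n)
  have hp : ∀ k x, polyTrace (p k) x = ∑ n ∈ Finset.range (N k), c k n * (fourier (n : ℤ) x : ℂ) := by
    intro k x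
    simp [p, polyTrace, Polynomial.eval_finsetSum, fourier_one_pow, -fourier_apply]
  have hcoef : ∀ k n, (p k).coeff n = if n < N k then c k n else 0 := by
    intro k n
    simp [p, Polynomial.coeff_monomial]
  refine ⟨p, ?_, ?_⟩
  · have hmem : ∀ k, MemLp (fun x => polyTrace (p k) x - g x) 2 ell := fun k =>
      (memHardy_polyTrace (p k) 2).1.sub hg.1
    have hS := fun k => hasSum_sq_norm_fourierCoeff (hmem k)
    have hd : ∀ k (n : ℤ), fourierCoeff (fun x => polyTrace (p k) x - g x) n
        = (if 0 ≤ n then (p k).coeff n.toNat else 0) - fourierCoeff g n := by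
      intro k n
      rw [fourierCoeff_fun_sub, fourierCoeff_polyTrace]
      · exact (memHardy_polyTrace (p k) 2).1.integrable (by norm_num)
      · exact hg.1.integrable (by norm_num)
    have hlim : ∀ n : ℤ, Tendsto (fun k =>
        ‖fourierCoeff (fun x => polyTrace (p k) x - g x) n‖ ^ 2) atTop (𝓝 0) := by
      intro n
      rcases lt_or_ge n 0 with hn | hn
      · refine tendsto_const_nhds.congr fun k => ?_
        rw [hd, if_neg (by omega), hg.2 n hn]; simp
      · have h1 : Tendsto (fun k => c k n.toNat - fourierCoeff g n) atTop (𝓝 0) := by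
          have := ((tendsto_arcMultiplier n).const_mul (fourierCoeff g n)).sub_const
            (fourierCoeff g n)
          simp only [mul_one, sub_self] at this
          simpa [c, Int.toNat_of_nonneg hn] using this
        have h2 : Tendsto (fun k => ‖c k n.toNat - fourierCoeff g n‖ ^ 2) atTop (𝓝 0) := by
          simpa using h1.norm.pow 2
        refine h2.congr' ?_
        filter_upwards [eventually_gt_atTop n.toNat] with k hk
        rw [hd, if_pos hn, hcoef, if_pos (hk.trans_le (hkN k))]
    have hbound : ∀ k (n : ℤ), ‖fourierCoeff (fun x => polyTrace (p k) x - g x) n‖ ^ 2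
        ≤ 4 * ‖fourierCoeff g n‖ ^ 2 := by
      intro k n
      have h1 : ‖(if 0 ≤ n then (p k).coeff n.toNat else 0)‖ ≤ ‖fourierCoeff g n‖ := by
        split_ifs with hn
        · rw [hcoef]
          split_ifs
          · simp only [c, Int.toNat_of_nonneg hn, norm_mul]
            exact mul_le_of_le_one_right (norm_nonneg _) (norm_arcMultiplier_le (hr k) n)
          · simp
        · simp
      have h2 : ‖fourierCoeff (fun x => polyTrace (p k) x - g x) n‖ ≤ 2 * ‖fourierCoeff g n‖ := by
        rw [hd]
        exact (norm_sub_le _ _).trans (by linarith)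
      nlinarith [norm_nonneg (fourierCoeff (fun x => polyTrace (p k) x - g x) n),
        norm_nonneg (fourierCoeff g n)]
    -- By Parseval, convergence in `L²` is dominated convergence for the sum of squared
    -- coefficients.
    have hT := tendsto_tsum_of_dominated_convergence
      (f := fun k (n : ℤ) => ‖fourierCoeff (fun x => polyTrace (p k) x - g x) n‖ ^ 2)
      (g := fun _ => (0 : ℝ)) (𝓕 := atTop)
      (bound := fun n => 4 * ‖fourierCoeff g n‖ ^ 2)
      ((hasSum_sq_norm_fourierCoeff hg.1).summable.mul_left 4) hlim
      (Eventually.of_forall fun k n => by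
        rw [Real.norm_of_nonneg (by positivity)]; exact hbound k n)
    simp only [(hS _).tsum_eq, tsum_zero] at hT
    have h3 : Tendsto (fun k => (eLpNorm (fun x => polyTrace (p k) x - g x) 2 ell).toReal)
        atTop (𝓝 0) := by
      have := hT.sqrt
      simpa [Real.sqrt_sq ENNReal.toReal_nonneg] using this
    rw [← ENNReal.tendsto_toReal_iff (fun k => (hmem k).2.ne) ENNReal.zero_ne_top]
    simpa using h3
  · intro k x
    rw [hp, ← (hsum k x).tsum_eq, ← (hsum k x).summable.sum_add_tsum_nat_add (N k),
      sub_add_cancel_left, norm_neg]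
    have hs : Summable fun n => ‖c k (n + N k) * (fourier ((n + N k : ℕ) : ℤ) x : ℂ)‖ := by
      simpa [norm_fourier_apply, -fourier_apply] using (summable_nat_add_iff (N k)).2 (hsn k)
    refine (norm_tsum_le_tsum_norm hs).trans ?_
    simp only [norm_mul, norm_fourier_apply, mul_one]
    exact (hN k).le

/-! ### Dominated convergence in `L^p` -/

lemma unifIntegrable_of_dominated {α : Type*} [MeasurableSpace α] {μ : Measure α} {p : ℝ≥0∞}
    (hp : 1 ≤ p) (hp' : p ≠ ⊤) {F : ℕ → α → ℂ} {G : α → ℝ} (hG : MemLp G p μ)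
    (hb : ∀ n, ∀ᵐ x ∂μ, ‖F n x‖ ≤ G x) : UnifIntegrable F p μ := by
  intro ε hε
  obtain ⟨δ, hδ, H⟩ := unifIntegrable_const (ι := Unit) hp hp' hG hε
  refine ⟨δ, hδ, fun n s hs hμ => le_trans (eLpNorm_mono_ae ?_) (H () s hs hμ)⟩
  filter_upwards [hb n] with x hx
  by_cases h : x ∈ s
  · simp only [Set.indicator_of_mem h]
    exact hx.trans (le_abs_self _)
  · simp [h]

/-- Vitali's theorem: a common majorant in `L^p` makes the sequence uniformly integrable. -/
lemma tendsto_eLpNorm_zero_of_dominated_of_tendstoInMeasure {α : Type*} [MeasurableSpace α]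
    {μ : Measure α} [IsFiniteMeasure μ] {p : ℝ≥0∞} (hp : 1 ≤ p) (hp' : p ≠ ⊤) {F : ℕ → α → ℂ}
    {G : α → ℝ} (hF : ∀ n, AEStronglyMeasurable (F n) μ) (hG : MemLp G p μ)
    (hb : ∀ n, ∀ᵐ x ∂μ, ‖F n x‖ ≤ G x) (h : TendstoInMeasure μ F atTop fun _ => 0) :
    Tendsto (fun n => eLpNorm (F n) p μ) atTop (𝓝 0) := by
  have := tendsto_Lp_finite_of_tendstoInMeasure hp hp' hF (MemLp.zero' (μ := μ) (p := p))
    (unifIntegrable_of_dominated hp hp' hG hb) h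
  refine this.congr fun n => ?_
  congr 1; ext x; simp

lemma tendsto_eLpNorm_zero_of_dominated {α : Type*} [MeasurableSpace α]
    {μ : Measure α} [IsFiniteMeasure μ] {p : ℝ≥0∞} (hp : 1 ≤ p) (hp' : p ≠ ⊤) {F : ℕ → α → ℂ}
    {G : α → ℝ} (hF : ∀ n, AEStronglyMeasurable (F n) μ) (hG : MemLp G p μ)
    (hb : ∀ n, ∀ᵐ x ∂μ, ‖F n x‖ ≤ G x) (h : ∀ᵐ x ∂μ, Tendsto (fun n => F n x) atTop (𝓝 0)) :
    Tendsto (fun n => eLpNorm (F n) p μ) atTop (𝓝 0) :=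
  tendsto_eLpNorm_zero_of_dominated_of_tendstoInMeasure hp hp' hF hG hb
    (tendstoInMeasure_of_tendsto_ae hF h)

/-! ### Exponentials of functions in `H²` -/

/-- Mean value property on the unit circle. -/
lemma integral_comp_fourier_one {Φ : ℂ → ℂ} (hΦ : Differentiable ℂ Φ) :
    ∫ x : UnitTorus, Φ (fourier 1 x) ∂ell = Φ 0 := by
  have h := DiffContOnCl.circleAverage (f := Φ) (c := 0) (R := 1) hΦ.diffContOnCl
  rw [← h, Real.circleAverage_def]
  have e := fourierCoeff_eq_intervalIntegral (T := 2 * π) (fun x => Φ (fourier 1 x)) 0 0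
  rw [fourierCoeff_zero_eq_integral] at e
  rw [e, zero_add, one_div]
  congr 1
  refine intervalIntegral.integral_congr fun θ _ => ?_
  simp only [neg_zero, fourier_zero, one_smul, circleMap, zero_add, Complex.ofReal_one, one_mul]
  congr 1
  rw [fourier_coe_apply]
  congr 1
  have : (π : ℂ) ≠ 0 := by exact_mod_cast Real.pi_ne_zero
  push_cast
  field_simp

lemma norm_exp_sub_exp_le {a b : ℂ} {M : ℝ} (ha : a.re ≤ M) (hb : b.re ≤ M) :
    ‖Complex.exp a - Complex.exp b‖ ≤ Real.exp M * ‖a - b‖ := by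
  refine Convex.norm_image_sub_le_of_norm_deriv_le (𝕜 := ℂ) (s := {z : ℂ | z.re ≤ M})
    (fun z _ => Complex.differentiableAt_exp) (fun z hz => ?_) (convex_halfSpace_re_le M) hb ha
  rw [Complex.deriv_exp, Complex.norm_exp]
  exact Real.exp_le_exp.2 hz

lemma memLp_mul_exp {g h : UnitTorus → ℂ} {p : ℝ≥0∞} (hg : MemLp g p ell)
    (hh : AEStronglyMeasurable h ell) {C : ℝ} (hC : ∀ᵐ x ∂ell, (h x).re ≤ C) :
    MemLp (fun x => g x * Complex.exp (h x)) p ell := by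
  refine hg.of_le_mul (c := Real.exp C)
    (hg.1.mul (Complex.continuous_exp.comp_aestronglyMeasurable hh)) ?_
  filter_upwards [hC] with x hx
  rw [norm_mul, mul_comm, Complex.norm_exp]
  gcongr

/-- On the half-plane `re ≤ M` the exponential is bounded and Lipschitz with constant `exp M`;
Cauchy–Schwarz handles the product with `g`. The common bound on the real parts is why the
approximating polynomials must follow local averages. -/
lemma tendsto_eLpNorm_mul_exp_sub {g h : UnitTorus → ℂ} (hg : MemLp g 2 ell) (hh : MemLp h 2 ell)
    {q p : ℕ → UnitTorus → ℂ} (hq : ∀ k, MemLp (q k) 2 ell) (hp : ∀ k, MemLp (p k) 2 ell)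
    {M : ℝ} (hM : ∀ᵐ x ∂ell, (h x).re ≤ M) (hpM : ∀ k, ∀ᵐ x ∂ell, (p k x).re ≤ M)
    (hqg : Tendsto (fun k => eLpNorm (fun x => q k x - g x) 2 ell) atTop (𝓝 0))
    (hph : Tendsto (fun k => eLpNorm (fun x => p k x - h x) 2 ell) atTop (𝓝 0)) :
    Tendsto (fun k => eLpNorm (fun x => q k x * Complex.exp (p k x) - g x * Complex.exp (h x))
      1 ell) atTop (𝓝 0) := by
  have hle : ∀ k, eLpNorm (fun x => q k x * Complex.exp (p k x) - g x * Complex.exp (h x)) 1 ell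
      ≤ ENNReal.ofReal (Real.exp M) * (eLpNorm (fun x => q k x - g x) 2 ell +
        eLpNorm g 2 ell * eLpNorm (fun x => p k x - h x) 2 ell) := by
    intro k
    have m1 : AEStronglyMeasurable (fun x => q k x - g x) ell := (hq k).1.sub hg.1
    have m2 : AEStronglyMeasurable (fun x => p k x - h x) ell := (hp k).1.sub hh.1
    have s1 : eLpNorm (fun x => q k x * Complex.exp (p k x) - g x * Complex.exp (h x)) 1 ell
        ≤ ENNReal.ofReal (Real.exp M) *
          eLpNorm (fun x => ‖q k x - g x‖ + ‖(g • fun x => p k x - h x) x‖) 1 ell := by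
      refine eLpNorm_le_mul_eLpNorm_of_ae_le_mul ?_ 1
      filter_upwards [hM, hpM k] with x h1 h2
      rw [Real.norm_of_nonneg (by positivity)]
      have e : q k x * Complex.exp (p k x) - g x * Complex.exp (h x)
        = (q k x - g x) * Complex.exp (p k x) +
          g x * (Complex.exp (p k x) - Complex.exp (h x)) := by ring
      rw [e]
      refine (norm_add_le _ _).trans ?_
      have a1 : ‖(q k x - g x) * Complex.exp (p k x)‖ ≤ Real.exp M * ‖q k x - g x‖ := by
        rw [norm_mul, mul_comm, Complex.norm_exp]; gcongr
      have a2 : ‖g x * (Complex.exp (p k x) - Complex.exp (h x))‖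
          ≤ Real.exp M * ‖(g • fun x => p k x - h x) x‖ := by
        simp only [Pi.smul_apply', smul_eq_mul, norm_mul]
        calc _ ≤ ‖g x‖ * (Real.exp M * ‖p k x - h x‖) := by
              gcongr; exact norm_exp_sub_exp_le h2 h1
          _ = _ := by ring
      linarith
    refine s1.trans ?_
    gcongr
    refine (eLpNorm_add_le m1.norm (hg.1.smul m2).norm le_rfl).trans ?_
    rw [eLpNorm_norm, eLpNorm_norm]
    gcongr
    · exact eLpNorm_le_eLpNorm_of_exponent_le (by norm_num) m1
    · exact eLpNorm_smul_le_mul_eLpNorm m2 hg.1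
  have hlim : Tendsto (fun k => ENNReal.ofReal (Real.exp M) *
      (eLpNorm (fun x => q k x - g x) 2 ell +
        eLpNorm g 2 ell * eLpNorm (fun x => p k x - h x) 2 ell)) atTop (𝓝 0) := by
    have := ENNReal.Tendsto.const_mul (a := ENNReal.ofReal (Real.exp M))
      (hqg.add (ENNReal.Tendsto.const_mul (a := eLpNorm g 2 ell) hph (Or.inr hg.2.ne)))
      (Or.inr ENNReal.ofReal_ne_top)
    simpa using this
  exact tendsto_of_tendsto_of_tendsto_of_le_of_le tendsto_const_nhds hlim (fun _ => zero_le) hle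

/-- The mean value property for `g e^h`, where `g` and `h` are in `H²` and the real part of `h` is
bounded above. -/
theorem MemHardy.integral_mul_exp {g h : UnitTorus → ℂ} (hg : MemHardy 2 g) (hh : MemHardy 2 h)
    {C : ℝ} (hC : ∀ᵐ x ∂ell, (h x).re ≤ C) :
    ∫ x, g x * Complex.exp (h x) ∂ell = (∫ x, g x ∂ell) * Complex.exp (∫ x, h x ∂ell) := by
  obtain ⟨q, hq, -⟩ := hg.exists_polynomial_seq
  obtain ⟨p, hp, hpa⟩ := hh.exists_polynomial_seq
  -- A half-plane is closed and convex, so averages of `h` keep real part at most `C`; the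
  -- polynomials differ from them by at most one.
  have hre : ∀ k x, (polyTrace (p k) x).re ≤ C + 1 := by
    intro k x
    have hr : (0 : ℝ) < 1 / ((k : ℝ) + 1) := by positivity
    have h1 : (⨍ y in Metric.ball x (1 / ((k : ℝ) + 1)), h y ∂ell).re ≤ C :=
      (convex_halfSpace_re_le C).set_average_mem (isClosed_le Complex.continuous_re continuous_const)
        (Metric.measure_ball_pos ell x hr).ne' (measure_ne_top _ _) (ae_restrict_of_ae hC)
        (hh.1.integrable (by norm_num)).integrableOn
    have h2 := (Complex.re_le_norm _).trans (hpa k x)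
    rw [Complex.sub_re] at h2
    have h3 : 1 / ((k : ℝ) + 1) ≤ 1 := by
      rw [div_le_one (by positivity)]; linarith [(Nat.cast_nonneg k : (0 : ℝ) ≤ k)]
    linarith
  have mq := fun k => (memHardy_polyTrace (q k) 2).1
  have mp := fun k => (memHardy_polyTrace (p k) 2).1
  have hC' : ∀ᵐ x ∂ell, (h x).re ≤ C + 1 := hC.mono fun x hx => by linarith
  have L := tendsto_eLpNorm_mul_exp_sub hg.1 hh.1 mq mp hC'
    (fun k => ae_of_all _ (hre k)) hq hp
  have I1 : Integrable (fun x => g x * Complex.exp (h x)) ell :=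
    (memLp_mul_exp hg.1 hh.1.1 hC).integrable (by norm_num)
  have T1 := tendsto_integral_of_L1' (μ := ell) _ I1.1 (F := fun k x =>
    polyTrace (q k) x * Complex.exp (polyTrace (p k) x)) (Eventually.of_forall fun k =>
      (memLp_mul_exp (mq k) (mp k).1 (ae_of_all _ (hre k))).integrable (by norm_num)) L
  have L1 : ∀ {u : UnitTorus → ℂ} (_ : MemHardy 2 u) {r : ℕ → Polynomial ℂ}
      (_ : Tendsto (fun k => eLpNorm (fun x => polyTrace (r k) x - u x) 2 ell) atTop (𝓝 0)),
      Tendsto (fun k => ∫ x, polyTrace (r k) x ∂ell) atTop (𝓝 (∫ x, u x ∂ell)) := by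
    intro u hu r hr
    refine tendsto_integral_of_L1' _ (hu.1.1) (Eventually.of_forall fun k =>
      (memHardy_polyTrace (r k) 2).1.integrable (by norm_num)) ?_
    exact tendsto_of_tendsto_of_tendsto_of_le_of_le tendsto_const_nhds hr (fun _ => zero_le)
      fun k => eLpNorm_le_eLpNorm_of_exponent_le (by norm_num)
        ((memHardy_polyTrace (r k) 2).1.1.sub hu.1.1)
  have T2 := (L1 hg hq).mul ((Complex.continuous_exp.tendsto _).comp (L1 hh hp))
  refine tendsto_nhds_unique T1 (T2.congr fun k => ?_)
  have d1 : Differentiable ℂ fun z => (q k).eval z := (q k).differentiable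
  have d2 : Differentiable ℂ fun z => (p k).eval z := (p k).differentiable
  -- For polynomial data all integrands are entire in `e^{iθ}`, and evaluation at `0` is
  -- multiplicative.
  have e1 := integral_comp_fourier_one d1
  have e2 := integral_comp_fourier_one d2
  have e3 := integral_comp_fourier_one (d1.mul d2.cexp)
  simp only [Function.comp, polyTrace]
  rw [e1, e2]
  exact e3.symm

lemma MemHardy.fourier_mul {g : UnitTorus → ℂ} {p : ℝ≥0∞} (hg : MemHardy p g) {m : ℤ}
    (hm : 0 ≤ m) : MemHardy p fun x => fourier m x * g x := by
  refine ⟨hg.1.of_le_mul (c := 1)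
    ((map_continuous (fourier m)).aestronglyMeasurable.mul hg.1.1)
    (ae_of_all _ fun x => by rw [norm_mul, norm_fourier_apply]), fun n hn => ?_⟩
  rw [fourierCoeff_fourier_mul, hg.2 _ (by omega)]

/-- For `n < 0`, the coefficient of index `n` is the mean of `(fourier (-n) * g) * exp h`. The first
factor is again in `H²` and has mean zero, so the mean value property applies. -/
lemma MemHardy.mul_exp {g h : UnitTorus → ℂ} (hg : MemHardy 2 g) (hh : MemHardy 2 h)
    {C : ℝ} (hC : ∀ᵐ x ∂ell, (h x).re ≤ C) :
    MemHardy 2 fun x => g x * Complex.exp (h x) := by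
  refine ⟨memLp_mul_exp hg.1 hh.1.1 hC, fun n hn => ?_⟩
  have := (hg.fourier_mul (m := -n) (by omega)).integral_mul_exp hh hC
  rw [← fourierCoeff_eq_integral g n, hg.2 n hn, zero_mul] at this
  rw [fourierCoeff_eq_integral, ← this]
  congr 1; ext x; ring

lemma MemHardy.const_mul {g : UnitTorus → ℂ} {p : ℝ≥0∞} (hg : MemHardy p g) (c : ℂ) :
    MemHardy p fun x => c * g x :=
  ⟨hg.1.const_mul c, fun n hn => by rw [fourierCoeff.const_mul, hg.2 n hn, mul_zero]⟩

lemma MemHardy.add {g h : UnitTorus → ℂ} (hg : MemHardy 2 g) (hh : MemHardy 2 h) :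
    MemHardy 2 fun x => g x + h x :=
  ⟨hg.1.add hh.1, fun n hn => by
    rw [fourierCoeff_fun_add (hg.1.integrable (by norm_num)) (hh.1.integrable (by norm_num)),
      hg.2 n hn, hh.2 n hn, add_zero]⟩

lemma MemHardy.sub {g h : UnitTorus → ℂ} (hg : MemHardy 2 g) (hh : MemHardy 2 h) :
    MemHardy 2 fun x => g x - h x :=
  ⟨hg.1.sub hh.1, fun n hn => by
    rw [fourierCoeff_fun_sub (hg.1.integrable (by norm_num)) (hh.1.integrable (by norm_num)),
      hg.2 n hn, hh.2 n hn, sub_zero]⟩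

/-- Every real function in `L²` is the real part of a function in `H²`. -/
theorem exists_memHardy_re_eq {w : UnitTorus → ℝ} (hw : MemLp w 2 ell) :
    ∃ h : UnitTorus → ℂ, MemHardy 2 h ∧ (∀ᵐ x ∂ell, (h x).re = w x) ∧
      ∫ x, h x ∂ell = ∫ x, w x ∂ell ∧ eLpNorm h 2 ell ≤ 2 * eLpNorm w 2 ell := by
  let W : UnitTorus → ℂ := fun x => (w x : ℂ)
  have hW : MemLp W 2 ell := hw.ofReal
  -- Doubling the positive frequencies and keeping the mean once makes the sum of `H` and its
  -- conjugate equal to `2 * W`. This doubling is also the source of the factor `2` in the norm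
  -- bound.
  let a : ℤ → ℂ := fun n => if n < 0 then 0 else if n = 0 then fourierCoeff W 0
    else 2 * fourierCoeff W n
  have ha : ∀ n, ‖a n‖ ^ 2 ≤ 4 * ‖fourierCoeff W n‖ ^ 2 := by
    intro n
    simp only [a]
    split_ifs with h1 h2
    · simp
    · rw [h2]; nlinarith [sq_nonneg ‖fourierCoeff W 0‖]
    · rw [norm_mul, mul_pow]; norm_num
  have hs := (hasSum_sq_norm_fourierCoeff hW).mul_left 4
  have hsa : Summable fun n => ‖a n‖ ^ 2 :=
    Summable.of_nonneg_of_le (fun _ => by positivity) ha hs.summable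
  have hmem : Memℓp a 2 := memℓp_gen (by simpa using hsa)
  let H : Lp ℂ 2 ell := ellBasis.repr.symm ⟨a, hmem⟩
  have hH : ∀ n, fourierCoeff (H : UnitTorus → ℂ) n = a n := by
    intro n
    rw [← ellBasis_repr, LinearIsometryEquiv.apply_symm_apply]
  have mH : MemLp (H : UnitTorus → ℂ) 2 ell := Lp.memLp H
  refine ⟨H, ⟨mH, fun n hn => by rw [hH]; simp [a, hn]⟩, ?_, ?_, ?_⟩
  · have m1 : MemLp (fun x => (starRingEnd ℂ) ((H : UnitTorus → ℂ) x)) 2 ell := mH.star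
    have mD := (m1.add mH).sub (hW.const_mul 2)
    have h0 := ae_eq_zero_of_fourierCoeff_eq_zero mD (fun n => by
      have e1 := fourierCoeff_fun_sub ((m1.add mH).integrable (by norm_num))
        ((hW.const_mul 2).integrable (by norm_num)) n
      have e2 := fourierCoeff_fun_add (m1.integrable (by norm_num)) (mH.integrable (by norm_num)) n
      have e4 : (starRingEnd ℂ) (fourierCoeff W (-n)) = fourierCoeff W n := by
        rw [← fourierCoeff_conj]; simp [W]
      refine e1.trans ?_
      rw [fourierCoeff.const_mul]
      have e3 : fourierCoeff ((fun x => (starRingEnd ℂ) ((H : UnitTorus → ℂ) x)) +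
        (H : UnitTorus → ℂ)) n = (starRingEnd ℂ) (a (-n)) + a n := by
        rw [← hH, ← hH, ← fourierCoeff_conj]; exact e2
      rw [e3]
      rcases lt_trichotomy n 0 with hn | hn | hn
      · have : ¬ (-n < 0) := by omega
        have h' : ¬ (-n = 0) := by omega
        simp only [a, if_pos hn, if_neg this, if_neg h', map_mul, map_ofNat, e4]
        ring
      · subst hn
        rw [neg_zero] at e4
        simp only [a, neg_zero, lt_irrefl, if_false, if_true, e4]
        ring
      · have : ¬ (n < 0) := by omega
        have h' : ¬ (n = 0) := by omega
        have h'' : -n < 0 := by omega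
        simp only [a, if_neg this, if_neg h', if_pos h'', map_zero]
        ring)
    filter_upwards [h0] with x hx
    have := congrArg Complex.re hx
    simp [W] at this
    linarith
  · rw [← fourierCoeff_zero_eq_integral, hH]
    simp only [a, lt_irrefl, if_false, if_true]
    rw [fourierCoeff_zero_eq_integral]
    exact integral_ofReal
  · have e : eLpNorm w 2 ell = eLpNorm W 2 ell :=
      eLpNorm_congr_norm_ae (ae_of_all _ fun x => by simp [W])
    rw [e, ← ENNReal.toReal_le_toReal mH.2.ne (ENNReal.mul_ne_top (by simp) hW.2.ne)]
    have h1 := hasSum_sq_norm_fourierCoeff mH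
    simp only [hH] at h1
    have h2 := hasSum_le ha h1 hs
    rw [ENNReal.toReal_mul]
    refine le_of_sq_le_sq ?_ (by positivity)
    simp only [ENNReal.toReal_ofNat]
    linarith

/-! ### Approximation by polynomials under the constraint -/

/-- Around a point of `J`, arcs of radius less than `δ` stay where `|g| ≤ 1`, so the averages are
bounded by one and the nearby polynomials by `1 + t k`. Dividing by `1 + t k` restores the bound at
a vanishing cost. -/
lemma exists_polynomial_of_bounded_thickening {J : Set UnitTorus} {δ : ℝ} (hδ : 0 < δ)
    {g : UnitTorus → ℂ} (hg : MemHardy 2 g)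
    (hb : ∀ᵐ x ∂ell, x ∈ Metric.thickening δ J → ‖g x‖ ≤ 1) {ε : ℝ≥0∞} (hε : 0 < ε) :
    ∃ q : Polynomial ℂ, (∀ x ∈ J, ‖polyTrace q x‖ ≤ 1) ∧
      eLpNorm (fun x => polyTrace q x - g x) 2 ell < ε := by
  obtain ⟨p, hp, hpa⟩ := hg.exists_polynomial_seq
  let t : ℕ → ℝ := fun k => 1 / ((k : ℝ) + 1)
  have ht0 : ∀ k, 0 < t k := fun k => by simp only [t]; positivity
  have ht : Tendsto t atTop (𝓝 0) := tendsto_one_div_add_atTop_nhds_zero_nat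
  let c : ℕ → ℝ := fun k => (1 + t k)⁻¹
  have hc1 : ∀ k, ‖c k‖ ≤ 1 := fun k => by
    rw [Real.norm_of_nonneg (by have := ht0 k; simp only [c]; positivity)]
    exact inv_le_one_of_one_le₀ (by linarith [ht0 k])
  have hct : Tendsto (fun k => c k - 1) atTop (𝓝 0) := by
    have h1 : Tendsto (fun k => 1 + t k) atTop (𝓝 1) := by simpa using ht.const_add 1
    have := (h1.inv₀ one_ne_zero).sub_const 1
    simpa [c] using this
  have hle : ∀ k, eLpNorm (fun x => polyTrace (Polynomial.C (c k : ℂ) * p k) x - g x) 2 ell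
      ≤ eLpNorm (fun x => polyTrace (p k) x - g x) 2 ell + ‖c k - 1‖ₑ * eLpNorm g 2 ell := by
    intro k
    have m1 : AEStronglyMeasurable (fun x => polyTrace (p k) x - g x) ell :=
      (memHardy_polyTrace (p k) 2).1.1.sub hg.1.1
    have e : (fun x => polyTrace (Polynomial.C (c k : ℂ) * p k) x - g x)
        = (c k • fun x => polyTrace (p k) x - g x) + (c k - 1) • g := by
      ext x
      simp only [polyTrace, Polynomial.eval_mul, Polynomial.eval_C, Pi.add_apply, Pi.smul_apply,
        Complex.real_smul]
      push_cast
      ring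
    rw [e]
    refine (eLpNorm_add_le (m1.const_smul _) (hg.1.1.const_smul _) (by norm_num)).trans ?_
    rw [eLpNorm_const_smul, eLpNorm_const_smul]
    gcongr
    refine mul_le_of_le_one_left zero_le ?_
    rw [← ofReal_norm]
    exact ENNReal.ofReal_le_one.2 (hc1 k)
  have hlim : Tendsto (fun k => eLpNorm (fun x => polyTrace (p k) x - g x) 2 ell
      + ‖c k - 1‖ₑ * eLpNorm g 2 ell) atTop (𝓝 0) := by
    have h1 : Tendsto (fun k => ‖c k - 1‖ₑ) atTop (𝓝 0) := by
      simpa using hct.enorm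
    have := hp.add (ENNReal.Tendsto.mul_const h1 (Or.inr hg.1.2.ne))
    simpa using this
  obtain ⟨k, hk, hk2⟩ := ((hlim.eventually (gt_mem_nhds hε)).and
    (ht.eventually (gt_mem_nhds hδ))).exists
  refine ⟨_, fun x hx => ?_, (hle k).trans_lt hk⟩
  have hav : ‖⨍ y in Metric.ball x (t k), g y ∂ell‖ ≤ 1 := by
    have := (convex_closedBall (0 : ℂ) 1).set_average_mem Metric.isClosed_closedBall
      (Metric.measure_ball_pos ell x (ht0 k)).ne' (measure_ne_top _ _) (f := g) (by
        rw [ae_restrict_iff' Metric.isOpen_ball.measurableSet]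
        filter_upwards [hb] with y hy hyb
        rw [mem_closedBall_zero_iff]
        exact hy (Metric.mem_thickening_iff.2 ⟨x, hx, (Metric.mem_ball.1 hyb).trans hk2⟩))
      (hg.1.integrable (by norm_num)).integrableOn
    simpa using this
  have h2 : ‖polyTrace (p k) x‖ ≤ 1 + t k := by
    have h3 := hpa k x
    have h4 : ‖polyTrace (p k) x‖ ≤ ‖polyTrace (p k) x - ⨍ y in Metric.ball x (t k), g y ∂ell‖
        + ‖⨍ y in Metric.ball x (t k), g y ∂ell‖ := by
      simpa using norm_add_le (polyTrace (p k) x - ⨍ y in Metric.ball x (t k), g y ∂ell)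
        (⨍ y in Metric.ball x (t k), g y ∂ell)
    have : t k = 1 / ((k : ℝ) + 1) := rfl
    linarith
  have h5 : polyTrace (Polynomial.C (c k : ℂ) * p k) x = (c k : ℂ) * polyTrace (p k) x := by
    simp [polyTrace]
  have h6 : 0 < 1 + t k := by linarith [ht0 k]
  rw [h5, norm_mul, Complex.norm_real, Real.norm_of_nonneg (by simp only [c]; positivity)]
  simp only [c]
  rw [inv_mul_le_iff₀ h6, mul_one]
  exact h2

/-- If `closure J \ J` is a null set, then every function in `H²` bounded by one on `J` is a limit
in `L²` of polynomials bounded by one on `J`. -/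
theorem MemHardy.exists_polynomial_bounded {J : Set UnitTorus} (hJ : MeasurableSet J)
    (hJ0 : ell (closure J \ J) = 0) {g : UnitTorus → ℂ} (hg : MemHardy 2 g)
    (hb : BoundedByOneOn J g) {ε : ℝ≥0∞} (hε : 0 < ε) :
    ∃ q : Polynomial ℂ, (∀ x ∈ J, ‖polyTrace q x‖ ≤ 1) ∧
      eLpNorm (fun x => polyTrace q x - g x) 2 ell < ε := by
  have hb' : ∀ᵐ x ∂ell, x ∈ J → ‖g x‖ ≤ 1 := (ae_restrict_iff' hJ).1 hb
  let δ : ℕ → ℝ := fun m => 1 / ((m : ℝ) + 1)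
  have hδ0 : ∀ m, 0 < δ m := fun m => by simp only [δ]; positivity
  have hδ : Tendsto δ atTop (𝓝 0) := tendsto_one_div_add_atTop_nhds_zero_nat
  -- These collars shrink to `closure J \ J`, a null set, so `g` restricted to them tends to zero in
  -- `L²`.
  let S : ℕ → Set UnitTorus := fun m => Metric.thickening (δ m) J \ J
  have hS : ∀ m, MeasurableSet (S m) := fun m => Metric.isOpen_thickening.measurableSet.diff hJ
  let w : ℕ → UnitTorus → ℝ := fun m => (S m).indicator fun x => ‖g x‖
  have hw : ∀ m, MemLp (w m) 2 ell := fun m => hg.1.norm.indicator (hS m)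
  have hw0 : ∀ m x, 0 ≤ w m x := fun m x => Set.indicator_nonneg (fun _ _ => norm_nonneg _) x
  choose h hh hre _ hnorm using fun m => exists_memHardy_re_eq (hw m)
  have hwlim : Tendsto (fun m => eLpNorm (w m) 2 ell) atTop (𝓝 0) := by
    have := tendsto_eLpNorm_zero_of_dominated (μ := ell) (p := 2) (by norm_num) (by norm_num)
      (F := fun m x => (w m x : ℂ)) (G := fun x => ‖g x‖) (fun m => (hw m).ofReal.1) hg.1.norm
      (fun m => ae_of_all _ fun x => by
        rw [Complex.norm_real, Real.norm_of_nonneg (hw0 m x)]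
        exact Set.indicator_le_self' (fun _ _ => norm_nonneg _) x) (by
        have h0 : ∀ᵐ x ∂ell, x ∉ closure J \ J := measure_eq_zero_iff_ae_notMem.1 hJ0
        filter_upwards [h0] with x hx
        refine tendsto_const_nhds.congr' ?_
        by_cases hxJ : x ∈ J
        · exact Eventually.of_forall fun m => by simp [w, S, hxJ]
        · have hxc : x ∉ closure J := fun hc => hx ⟨hc, hxJ⟩
          rw [Metric.closure_eq_iInter_thickening] at hxc
          simp only [Set.mem_iInter, not_forall] at hxc
          obtain ⟨η, hη, hxη⟩ := hxc
          filter_upwards [hδ.eventually (gt_mem_nhds hη)] with m hm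
          have : x ∉ S m := fun hs => hxη (Metric.thickening_mono hm.le J hs.1)
          simp [w, this])
    refine this.congr fun m => eLpNorm_congr_norm_ae (ae_of_all _ fun x => by simp)
  have hhlim : Tendsto (fun m => eLpNorm (h m) 2 ell) atTop (𝓝 0) := by
    have := ENNReal.Tendsto.const_mul (a := 2) hwlim (Or.inr (by simp))
    rw [mul_zero] at this
    exact tendsto_of_tendsto_of_tendsto_of_le_of_le tendsto_const_nhds this (fun _ => zero_le) hnorm
  obtain ⟨φ, hφ, hφlim⟩ := (tendstoInMeasure_of_tendsto_eLpNorm (p := 2) (f := h) (g := 0)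
    (l := atTop) (by norm_num) (fun m => (hh m).1.1) aestronglyMeasurable_zero
    (by simpa using hhlim)).exists_seq_tendsto_ae
  -- With `h m` of real part `w m`, the modulus is unchanged on `J` and becomes `|g| * exp (-|g|)`
  -- on the collar, at most one since `t + 1 ≤ exp t`. Multiplication by an exponential stays in
  -- `H²`.
  let G : ℕ → UnitTorus → ℂ := fun m x => g x * Complex.exp (-1 * h m x)
  have hnre : ∀ m, ∀ᵐ x ∂ell, (-1 * h m x).re = - w m x := fun m => by
    filter_upwards [hre m] with x hx
    simp [hx]
  have hG : ∀ m, MemHardy 2 (G m) := fun m => hg.mul_exp ((hh m).const_mul (-1)) (C := 0) (by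
    filter_upwards [hnre m] with x hx
    rw [hx]; linarith [hw0 m x])
  have hGn : ∀ m, ∀ᵐ x ∂ell, ‖G m x‖ = ‖g x‖ * Real.exp (- w m x) := fun m => by
    filter_upwards [hnre m] with x hx
    rw [norm_mul, Complex.norm_exp, hx]
  have hGle : ∀ m, ∀ᵐ x ∂ell, ‖G m x‖ ≤ ‖g x‖ := fun m => by
    filter_upwards [hGn m] with x hx
    rw [hx]
    exact mul_le_of_le_one_right (norm_nonneg _) (Real.exp_le_one_iff.2 (by linarith [hw0 m x]))
  have hGb : ∀ m, ∀ᵐ x ∂ell, x ∈ Metric.thickening (δ m) J → ‖G m x‖ ≤ 1 := fun m => by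
    filter_upwards [hGn m, hGle m, hb'] with x hx hx2 hx3 hxt
    by_cases hxJ : x ∈ J
    · exact hx2.trans (hx3 hxJ)
    · have hwx : w m x = ‖g x‖ := Set.indicator_of_mem (show x ∈ S m from ⟨hxt, hxJ⟩) _
      rw [hx, hwx, Real.exp_neg, ← div_eq_mul_inv, div_le_one (Real.exp_pos _)]
      linarith [Real.add_one_le_exp ‖g x‖]
  have hGlim : Tendsto (fun m => eLpNorm (fun x => G (φ m) x - g x) 2 ell) atTop (𝓝 0) := by
    refine tendsto_eLpNorm_zero_of_dominated (by norm_num) (by norm_num)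
      (G := fun x => 2 * ‖g x‖) (fun m => (hG _).1.1.sub hg.1.1) (hg.1.norm.const_mul 2)
      (fun m => ?_) ?_
    · filter_upwards [hGle (φ m)] with x hx
      exact (norm_sub_le _ _).trans (by linarith)
    · filter_upwards [hφlim] with x hx
      have hcont : Continuous fun z : ℂ => g x * Complex.exp (-1 * z) - g x := by fun_prop
      have := (hcont.tendsto 0).comp hx
      simpa [G, Function.comp_def] using this
  obtain ⟨m, hm⟩ := (hGlim.eventually (gt_mem_nhds (ENNReal.half_pos hε.ne'))).exists
  obtain ⟨q, hq1, hq2⟩ := exists_polynomial_of_bounded_thickening (hδ0 (φ m)) (hG (φ m))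
    (hGb (φ m)) (ENNReal.half_pos hε.ne')
  refine ⟨q, hq1, ?_⟩
  have e : (fun x => polyTrace q x - g x) =
      (fun x => polyTrace q x - G (φ m) x) + fun x => G (φ m) x - g x := by
    ext x; simp
  rw [e]
  refine (eLpNorm_add_le ((memHardy_polyTrace q 2).1.1.sub (hG _).1.1)
    ((hG _).1.1.sub hg.1.1) (by norm_num)).trans_lt ?_
  exact (ENNReal.add_lt_add hq2 hm).trans_eq (ENNReal.add_halves ε)

/-! ### Sequences in `H²` that are small on a set of positive measure -/

/-- Take `h` in `H²` with real part `1_E`, hence of mean `ℓ(E)`. Then `exp (c * h)` has modulus `exp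
c` on `E` and one elsewhere, while the mean of `d * exp (c * h)` is that of `d` times `exp (c *
ℓ(E))`. -/
lemma MemHardy.norm_integral_le_of_indicator {E : Set UnitTorus} (hE : MeasurableSet E)
    {d : UnitTorus → ℂ} (hd : MemHardy 2 d) {c : ℝ} (hc : 0 ≤ c) :
    ‖∫ x, d x ∂ell‖ ≤ Real.exp (-(c * ell.real E)) *
      (∫ x, ‖d x‖ ∂ell + Real.exp c * ∫ x in E, ‖d x‖ ∂ell) := by
  have hw : MemLp (E.indicator fun _ => (1 : ℝ)) 2 ell :=
    memLp_indicator_const 2 hE 1 (Or.inr (measure_ne_top _ _))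
  obtain ⟨h, hh, hre, hint, -⟩ := exists_memHardy_re_eq hw
  rw [integral_indicator_const _ hE, smul_eq_mul, mul_one] at hint
  have hre' : ∀ᵐ x ∂ell, ((c : ℂ) * h x).re = c * E.indicator (fun _ => (1 : ℝ)) x := by
    filter_upwards [hre] with x hx
    rw [Complex.re_ofReal_mul, hx]
  have hC : ∀ᵐ x ∂ell, ((c : ℂ) * h x).re ≤ c := by
    filter_upwards [hre'] with x hx
    rw [hx]
    by_cases hxE : x ∈ E <;> simp [hxE, hc]
  have key := hd.integral_mul_exp (hh.const_mul c) hC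
  rw [integral_const_mul, hint, ← Complex.ofReal_mul, ← Complex.ofReal_exp] at key
  have hdi : Integrable (fun x => ‖d x‖) ell := (hd.1.integrable (by norm_num)).norm
  have hle : ‖∫ x, d x * Complex.exp (c * h x) ∂ell‖
      ≤ ∫ x, ‖d x‖ ∂ell + Real.exp c * ∫ x in E, ‖d x‖ ∂ell := by
    refine (norm_integral_le_integral_norm _).trans ?_
    rw [← integral_indicator hE, ← integral_const_mul, ← integral_add hdi
      ((hdi.indicator hE).const_mul _)]
    refine integral_mono_ae (memLp_mul_exp hd.1 (hh.const_mul c).1.1 hC |>.integrable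
      (by norm_num)).norm (hdi.add ((hdi.indicator hE).const_mul _)) ?_
    filter_upwards [hre'] with x hx
    simp only [norm_mul, Complex.norm_exp, hx]
    by_cases hxE : x ∈ E
    · simp only [Set.indicator_of_mem hxE, mul_one]
      nlinarith [norm_nonneg (d x)]
    · simp [Set.indicator_of_notMem hxE]
  rw [key, norm_mul, Complex.norm_real, Real.norm_of_nonneg (Real.exp_pos _).le] at hle
  rw [Real.exp_neg, ← div_eq_inv_mul, le_div_iff₀ (Real.exp_pos _)]
  exact hle

lemma tendsto_fourierCoeff_zero {E : Set UnitTorus} (hE : MeasurableSet E) (hE0 : 0 < ell E)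
    {d : ℕ → UnitTorus → ℂ} (hd : ∀ n, MemHardy 2 (d n)) {M : ℝ}
    (hM : ∀ n, ∫ x, ‖d n x‖ ∂ell ≤ M)
    (hlim : Tendsto (fun n => ∫ x in E, ‖d n x‖ ∂ell) atTop (𝓝 0)) :
    Tendsto (fun n => fourierCoeff (d n) 0) atTop (𝓝 0) := by
  have hpos : 0 < ell.real E := ENNReal.toReal_pos hE0.ne' (measure_ne_top _ _)
  have hA : Tendsto (fun c : ℝ => Real.exp (-(c * ell.real E)) * M) atTop (𝓝 0) := by
    have h1 : Tendsto (fun c : ℝ => -(c * ell.real E)) atTop atBot :=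
      tendsto_neg_atTop_atBot.comp (tendsto_id.atTop_mul_const hpos)
    simpa using (Real.tendsto_exp_atBot.comp h1).mul_const M
  rw [Metric.tendsto_atTop]
  intro ε hε
  -- The parameter `c` is fixed first, to absorb the `L¹` bound; only then is `n` taken large, so
  -- the factor `exp c` on `E` is harmless.
  obtain ⟨c, hc1, hc0⟩ := ((hA.eventually (gt_mem_nhds (half_pos hε))).and
    (eventually_ge_atTop 0)).exists
  have hB : Tendsto (fun n => Real.exp (-(c * ell.real E)) *
      (Real.exp c * ∫ x in E, ‖d n x‖ ∂ell)) atTop (𝓝 0) := by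
    simpa using (hlim.const_mul (Real.exp c)).const_mul (Real.exp (-(c * ell.real E)))
  obtain ⟨N, hN⟩ := eventually_atTop.1 (hB.eventually (gt_mem_nhds (half_pos hε)))
  refine ⟨N, fun n hn => ?_⟩
  rw [dist_zero_right, fourierCoeff_zero_eq_integral]
  have h1 := (hd n).norm_integral_le_of_indicator hE hc0
  have h2 := mul_le_mul_of_nonneg_left (hM n) (Real.exp_pos (-(c * ell.real E))).le
  have h3 := hN n hn
  rw [mul_add] at h1
  linarith

/-- If a sequence in `H²`, bounded in `L¹`, tends to `0` in `L¹(E)` for a set `E` of positive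
measure, then its Fourier coefficients tend to `0`. -/
theorem tendsto_fourierCoeff_of_tendsto_zero_on {E : Set UnitTorus} (hE : MeasurableSet E)
    (hE0 : 0 < ell E) {d : ℕ → UnitTorus → ℂ} (hd : ∀ n, MemHardy 2 (d n)) {M : ℝ}
    (hM : ∀ n, ∫ x, ‖d n x‖ ∂ell ≤ M)
    (hlim : Tendsto (fun n => ∫ x in E, ‖d n x‖ ∂ell) atTop (𝓝 0)) (m : ℤ) :
    Tendsto (fun n => fourierCoeff (d n) m) atTop (𝓝 0) := by
  rcases lt_or_ge m 0 with hm | hm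
  · exact tendsto_const_nhds.congr fun n => ((hd n).2 m hm).symm
  lift m to ℕ using hm
  induction m generalizing d M with
  | zero => exact tendsto_fourierCoeff_zero hE hE0 hd hM hlim
  | succ m ih =>
    have h0 := tendsto_fourierCoeff_zero hE hE0 hd hM hlim
    have hi := fun n => (hd n).1.integrable (q := 2) (by norm_num)
    let a : ℕ → ℂ := fun n => fourierCoeff (d n) 0
    -- Backward shift: removing the mean and dividing by `e^{iθ}` stays in `H²`, lowers each index
    -- by one, and at most doubles the `L¹` bound. Smallness on `E` survives because the means tend
    -- to zero.
    let D : ℕ → UnitTorus → ℂ := fun n x => fourier (-1) x * (d n x - a n)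
    have hai : ∀ n, Integrable (fun _ : UnitTorus => a n) ell := fun n => integrable_const _
    have hcoef : ∀ n (j : ℤ), fourierCoeff (D n) j =
        fourierCoeff (d n) (j + 1) - if j + 1 = 0 then a n else 0 := by
      intro n j
      rw [fourierCoeff_fourier_mul, sub_neg_eq_add, fourierCoeff_fun_sub (hi n) (hai n)]
      have e : fourierCoeff (fun _ : UnitTorus => a n) (j + 1) = if j + 1 = 0 then a n else 0 := by
        have e' : polyTrace (Polynomial.C (a n)) = fun _ => a n := by ext; simp [polyTrace]
        rw [← e', fourierCoeff_polyTrace, Polynomial.coeff_C]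
        split_ifs <;> first | rfl | omega
      rw [e]
    have hDn : ∀ n x, ‖D n x‖ ≤ ‖d n x‖ + ‖a n‖ := fun n x => by
      simp only [D, norm_mul, norm_fourier_apply, one_mul]
      exact norm_sub_le _ _
    have hDm : ∀ n, MemHardy 2 (D n) := by
      intro n
      refine ⟨((hd n).1.sub (memLp_const (a n))).of_le_mul (c := 1)
        ((map_continuous (fourier (-1))).aestronglyMeasurable.mul
          ((hd n).1.1.sub aestronglyMeasurable_const))
        (ae_of_all _ fun x => by
          rw [norm_mul, norm_fourier_apply]; rfl), fun j hj => ?_⟩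
      rw [hcoef]
      split_ifs with h
      · rw [h, sub_self]
      · rw [(hd n).2 _ (by omega), sub_zero]
    have hDi := fun n => ((hDm n).1.integrable (q := 2) (by norm_num)).norm
    have han : ∀ n, ‖a n‖ ≤ M := fun n => (norm_fourierCoeff_le _ _).trans (hM n)
    have hlimD := ih (d := D) (M := M + M) hDm (fun n => by
        refine (integral_mono (hDi n) ((hi n).norm.add (integrable_const ‖a n‖)) (hDn n)).trans ?_
        rw [integral_add' (hi n).norm (integrable_const _)]
        simp only [integral_const, probReal_univ, one_smul]
        exact add_le_add (hM n) (han n)) (by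
        have hup : Tendsto (fun n => ∫ x in E, ‖d n x‖ ∂ell + ‖a n‖) atTop (𝓝 0) := by
          simpa using hlim.add h0.norm
        refine squeeze_zero (fun n => integral_nonneg fun _ => norm_nonneg _) (fun n => ?_) hup
        refine (integral_mono (hDi n).integrableOn ((hi n).norm.integrableOn.add
          (integrable_const ‖a n‖)) (hDn n)).trans ?_
        rw [integral_add' (hi n).norm.integrableOn (integrable_const _)]
        gcongr
        simp only [integral_const, smul_eq_mul]
        refine mul_le_of_le_one_left (norm_nonneg _) ?_
        rw [measureReal_restrict_apply_univ]
        exact measureReal_le_one)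
    refine hlimD.congr fun n => ?_
    rw [hcoef, if_neg (by omega), sub_zero]
    push_cast; rfl

/-! ### Finite unions of closed arcs -/

lemma ell_singleton (x : UnitTorus) : ell {x} = 0 := by
  have h := AddCircle.volume_closedBall (2 * π) (x := x) 0
  rw [Metric.closedBall_zero, volume_eq_smul_haarAddCircle] at h
  simp only [mul_zero, min_eq_right Real.two_pi_pos.le, ENNReal.ofReal_zero, Measure.smul_apply,
    smul_eq_mul, mul_eq_zero, ENNReal.ofReal_eq_zero, not_le.2 Real.two_pi_pos, false_or] at h
  exact h

/-- The quotient map is open, so the image of the open interval is open and only the endpoints can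
fail to be interior. -/
lemma arc_diff_interior_subset (a b : ℝ) :
    ((fun θ : ℝ => (θ : UnitTorus)) '' Set.Icc a b) \
      interior ((fun θ : ℝ => (θ : UnitTorus)) '' Set.Icc a b) ⊆ {(a : UnitTorus), (b : UnitTorus)} := by
  rintro x ⟨⟨θ, hθ, rfl⟩, hx⟩
  have hopen : IsOpen ((fun θ : ℝ => (θ : UnitTorus)) '' Set.Ioo a b) :=
    QuotientAddGroup.isOpenMap_coe _ isOpen_Ioo
  have hn : θ ∉ Set.Ioo a b := fun h => hx
    (interior_maximal (Set.image_mono Set.Ioo_subset_Icc_self) hopen ⟨θ, h, rfl⟩)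
  rcases eq_or_lt_of_le hθ.1 with h | h
  · left; simp [h]
  · rcases eq_or_lt_of_le hθ.2 with h' | h'
    · right; simp [h']
    · exact absurd ⟨h, h'⟩ hn

lemma IsFiniteUnionOfClosedArcs.isClosed {I : Set UnitTorus} (hI : IsFiniteUnionOfClosedArcs I) :
    IsClosed I := by
  obtain ⟨N, a, b, rfl⟩ := hI
  exact isClosed_iUnion_of_finite fun j =>
    (isCompact_Icc.image (AddCircle.continuous_mk' _)).isClosed

lemma IsFiniteUnionOfClosedArcs.measure_diff_interior {I : Set UnitTorus}
    (hI : IsFiniteUnionOfClosedArcs I) : ell (I \ interior I) = 0 := by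
  obtain ⟨N, a, b, rfl⟩ := hI
  refine measure_mono_null (t := ⋃ j, {(a j : UnitTorus), (b j : UnitTorus)}) ?_ ?_
  · rintro x ⟨hx, hx'⟩
    obtain ⟨j, hj⟩ := Set.mem_iUnion.1 hx
    refine Set.mem_iUnion.2 ⟨j, arc_diff_interior_subset (a j) (b j) ⟨hj, fun h => hx' ?_⟩⟩
    exact interior_mono (Set.subset_iUnion
      (fun j => (fun θ : ℝ => (θ : UnitTorus)) '' Set.Icc (a j) (b j)) j) h
  · have hfin : (⋃ j, {(a j : UnitTorus), (b j : UnitTorus)}).Finite :=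
      Set.finite_iUnion fun j => Set.toFinite _
    rw [← Set.biUnion_of_singleton (⋃ j, {(a j : UnitTorus), (b j : UnitTorus)})]
    exact (measure_biUnion_null_iff hfin.countable).2 fun x _ => ell_singleton x

lemma IsFiniteUnionOfClosedArcs.measure_closure_compl_diff {I : Set UnitTorus}
    (hI : IsFiniteUnionOfClosedArcs I) : ell (closure Iᶜ \ Iᶜ) = 0 := by
  rw [closure_compl, Set.sdiff_compl, Set.inter_comm, ← Set.sdiff_eq]
  exact hI.measure_diff_interior

/-! ### Convergence on `I` -/

lemma integral_norm_le_lpNormOn {d : UnitTorus → ℂ} (E : Set UnitTorus)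
    (hd : MemLp d 2 (ell.restrict E)) :
    ∫ x in E, ‖d x‖ ∂ell ≤ (lpNormOn 2 E d).toReal := by
  rw [integral_norm_eq_lintegral_enorm hd.1, ← eLpNorm_one_eq_lintegral_enorm]
  refine ENNReal.toReal_mono hd.2.ne ?_
  refine (eLpNorm_le_eLpNorm_mul_rpow_measure_univ (p := 1) (q := 2) (by norm_num) hd.1).trans ?_
  refine mul_le_of_le_one_right zero_le (ENNReal.rpow_le_one ?_ (by norm_num))
  rw [Measure.restrict_apply_univ]
  exact prob_le_one

/-- The values of the polynomial problems converge to the value of the extremal problem, and so do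
their solutions. -/
theorem tendsto_lpNormOn_of_isFBEPSolution {I : Set UnitTorus} (hIm : MeasurableSet I)
    (hI0 : ell (closure Iᶜ \ Iᶜ) = 0) {f g₀ : UnitTorus → ℂ} (hf : MemLpOn 2 I f)
    (hg₀ : IsBEPSolution I f g₀) {k : ℕ → Polynomial ℂ} (hk : ∀ n, IsFBEPSolution I f n (k n)) :
    Tendsto (fun n => lpNormOn 2 I fun x => g₀ x - polyTrace (k n) x) atTop (𝓝 0) := by
  obtain ⟨hgH, hgb, hmin⟩ := hg₀
  have mk : ∀ q : Polynomial ℂ, MemLp (polyTrace q) 2 (ell.restrict I) := fun q =>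
    (memHardy_polyTrace q 2).1.restrict I
  have mg : MemLp g₀ 2 (ell.restrict I) := hgH.1.restrict I
  let F : Lp ℂ 2 (ell.restrict I) := hf.toLp f
  let G : Lp ℂ 2 (ell.restrict I) := mg.toLp g₀
  let Q : Polynomial ℂ → Lp ℂ 2 (ell.restrict I) := fun q => (mk q).toLp _
  have nfq : ∀ q, ‖F - Q q‖ = (lpNormOn 2 I fun x => f x - polyTrace q x).toReal := fun q =>
    Lp.norm_toLp _ (hf.sub (mk q))
  have nfg : ‖F - G‖ = (lpNormOn 2 I fun x => f x - g₀ x).toReal :=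
    Lp.norm_toLp _ (hf.sub mg)
  have ngq : ∀ q, ‖G - Q q‖ = (lpNormOn 2 I fun x => g₀ x - polyTrace q x).toReal := fun q =>
    Lp.norm_toLp _ (mg.sub (mk q))
  -- The constraint is convex, so the midpoint of `g₀` and `k n` is a competitor.
  have hmid : ∀ n, ‖F - G‖ ≤ ‖F - (1 / 2 : ℝ) • (G + Q (k n))‖ := by
    intro n
    have h1 := hmin (fun x => (1 / 2 : ℂ) * (g₀ x + polyTrace (k n) x))
      ((hgH.add (memHardy_polyTrace (k n) 2)).const_mul _) (by
        filter_upwards [hgb, (hk n).2.1] with x h1 h2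
        rw [norm_mul]
        have := norm_add_le (g₀ x) (polyTrace (k n) x)
        norm_num
        linarith)
    have m3 : MemLp ((1 / 2 : ℝ) • (g₀ + polyTrace (k n))) 2 (ell.restrict I) :=
      (mg.add (mk (k n))).const_smul _
    have e : F - (1 / 2 : ℝ) • (G + Q (k n)) = (hf.sub m3).toLp _ := rfl
    rw [nfg, e, Lp.norm_toLp]
    refine ENNReal.toReal_mono (hf.sub m3).2.ne (h1.trans_eq ?_)
    refine eLpNorm_congr_ae (ae_of_all _ fun x => ?_)
    simp [mul_add]
  have hlow : ∀ n, ‖F - G‖ ≤ ‖F - Q (k n)‖ := fun n => by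
    rw [nfg, nfq]
    exact ENNReal.toReal_mono (hf.sub (mk _)).2.ne
      (hmin _ (memHardy_polyTrace (k n) 2) (hk n).2.1)
  have hval : Tendsto (fun n => ‖F - Q (k n)‖) atTop (𝓝 ‖F - G‖) := by
    rw [Metric.tendsto_atTop]
    intro ε hε
    obtain ⟨q, hq1, hq2⟩ := hgH.exists_polynomial_bounded hIm.compl hI0 hgb
      (ε := ENNReal.ofReal ε) (by simpa using hε)
    refine ⟨q.natDegree, fun n hn => ?_⟩
    have h1 : ‖F - Q (k n)‖ ≤ ‖F - Q q‖ := by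
      rw [nfq, nfq]
      exact ENNReal.toReal_mono (hf.sub (mk _)).2.ne ((hk n).2.2 q hn
        (ae_restrict_of_forall_mem hIm.compl hq1))
    have h2 : ‖Q q - G‖ < ε := by
      have e : Q q - G = ((mk q).sub mg).toLp _ := rfl
      rw [e, Lp.norm_toLp]
      refine ENNReal.toReal_lt_of_lt_ofReal (lt_of_le_of_lt ?_ hq2)
      exact eLpNorm_mono_measure _ Measure.restrict_le_self
    have h3 : ‖F - Q q‖ ≤ ‖F - G‖ + ‖Q q - G‖ := by
      have := norm_sub_le (F - G) (Q q - G)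
      rwa [sub_sub_sub_cancel_right] at this
    rw [Real.dist_eq, abs_of_nonneg (sub_nonneg.2 (hlow n))]
    linarith
  have hsq : Tendsto (fun n => ‖G - Q (k n)‖) atTop (𝓝 0) := by
    -- In the parallelogram law for `F - Q (k n)` and `F - G`, the sum is twice the vector from the
    -- midpoint to `F`, of norm at least `2 * ‖F - G‖`.
    have hup : Tendsto (fun n => √(2 * ‖F - Q (k n)‖ ^ 2 - 2 * ‖F - G‖ ^ 2)) atTop (𝓝 0) := by
      have := (((hval.pow 2).const_mul 2).sub_const (2 * ‖F - G‖ ^ 2)).sqrt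
      simpa using this
    refine squeeze_zero (fun _ => norm_nonneg _) (fun n => Real.le_sqrt_of_sq_le ?_) hup
    have hpar := parallelogram_law_with_norm ℝ (F - Q (k n)) (F - G)
    have e1 : (F - Q (k n)) + (F - G) = (2 : ℝ) • (F - (1 / 2 : ℝ) • (G + Q (k n))) := by
      module
    rw [e1, norm_smul, sub_sub_sub_cancel_left, Real.norm_ofNat] at hpar
    have := hmid n
    nlinarith [norm_nonneg (F - G)]
  refine (ENNReal.tendsto_toReal_iff (f := fun n => lpNormOn 2 I fun x => g₀ x - polyTrace (k n) x)
    (fun n => (mg.sub (mk (k n))).2.ne) ENNReal.zero_ne_top).1 ?_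
  simpa [ngq] using hsq

/-! ### Weak convergence -/

lemma tendsto_zero_of_span_dense {X : Type*} [NormedAddCommGroup X] [NormedSpace ℂ X]
    (φ : ℕ → X →ₗ[ℂ] ℂ) {C : ℝ} (hφ : ∀ n x, ‖φ n x‖ ≤ C * ‖x‖) {s : Set X}
    (hs : (Submodule.span ℂ s).topologicalClosure = ⊤)
    (h : ∀ x ∈ s, Tendsto (fun n => φ n x) atTop (𝓝 0)) (x : X) :
    Tendsto (fun n => φ n x) atTop (𝓝 0) := by
  have hspan : ∀ y ∈ Submodule.span ℂ s, Tendsto (fun n => φ n y) atTop (𝓝 0) := by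
    intro y hy
    induction hy using Submodule.span_induction with
    | mem y hy => exact h y hy
    | zero => simp
    | add y z _ _ h1 h2 => simpa using h1.add h2
    | smul c y _ h1 => simpa using h1.const_mul c
  have hx : x ∈ closure (Submodule.span ℂ s : Set X) := by
    rw [← Submodule.topologicalClosure_coe, hs]; trivial
  rw [Metric.tendsto_atTop]
  intro ε hε
  obtain ⟨y, hy, hxy⟩ := Metric.mem_closure_iff.1 hx (ε / 2 / (|C| + 1)) (by positivity)
  obtain ⟨N, hN⟩ := Metric.tendsto_atTop.1 (hspan y hy) (ε / 2) (by positivity)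
  refine ⟨N, fun n hn => ?_⟩
  have h1 := hN n hn
  rw [dist_zero_right] at h1 ⊢
  have h2 : ‖φ n (x - y)‖ < ε / 2 := by
    refine (hφ n _).trans_lt ?_
    rw [dist_eq_norm, lt_div_iff₀ (by positivity)] at hxy
    nlinarith [le_abs_self C, norm_nonneg (x - y)]
  have h3 : φ n x = φ n (x - y) + φ n y := by rw [← map_add, sub_add_cancel]
  rw [h3]
  exact (norm_add_le _ _).trans_lt (by linarith)

/-- Testing against a monomial over `Iᶜ` gives a Fourier coefficient minus an integral over `I`, and
both vanish in the limit. The bound on `Iᶜ` makes the functionals uniformly bounded on `L¹`, where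
trigonometric polynomials are dense. -/
lemma tendsto_setIntegral_compl_mul {I : Set UnitTorus} (hIm : MeasurableSet I)
    {d : ℕ → UnitTorus → ℂ} (hd : ∀ n, Integrable (d n) ell) {C : ℝ}
    (hb : ∀ n, ∀ᵐ x ∂(ell.restrict Iᶜ), ‖d n x‖ ≤ C)
    (hI : Tendsto (fun n => ∫ x in I, ‖d n x‖ ∂ell) atTop (𝓝 0))
    (hc : ∀ m, Tendsto (fun n => fourierCoeff (d n) m) atTop (𝓝 0))
    {h : UnitTorus → ℂ} (hh : Integrable h (ell.restrict Iᶜ)) :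
    Tendsto (fun n => ∫ x in Iᶜ, d n x * h x ∂ell) atTop (𝓝 0) := by
  have hint : ∀ n {u : UnitTorus → ℂ}, Integrable u (ell.restrict Iᶜ) →
      Integrable (fun x => d n x * u x) (ell.restrict Iᶜ) := fun n u hu =>
    hu.bdd_mul (hd n).1.restrict (hb n)
  have hL1 : ∀ u : Lp ℂ 1 ell, Integrable (u : UnitTorus → ℂ) (ell.restrict Iᶜ) := fun u =>
    (L1.integrable_coeFn u).integrableOn
  let φ : ℕ → Lp ℂ 1 ell →ₗ[ℂ] ℂ := fun n =>
    { toFun := fun u => ∫ x in Iᶜ, d n x * (u : UnitTorus → ℂ) x ∂ell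
      map_add' := fun u v => by
        rw [← integral_add (hint n (hL1 u)) (hint n (hL1 v))]
        refine integral_congr_ae (ae_restrict_of_ae ?_)
        filter_upwards [Lp.coeFn_add u v] with x hx
        rw [hx, Pi.add_apply, mul_add]
      map_smul' := fun c u => by
        rw [RingHom.id_apply, smul_eq_mul, ← integral_const_mul]
        refine integral_congr_ae (ae_restrict_of_ae ?_)
        filter_upwards [Lp.coeFn_smul c u] with x hx
        rw [hx, Pi.smul_apply, smul_eq_mul]; ring }
  have hC : 0 ≤ |C| := abs_nonneg C
  have hφ : ∀ n u, ‖φ n u‖ ≤ |C| * ‖u‖ := by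
    intro n u
    refine (norm_integral_le_integral_norm _).trans ?_
    rw [L1.norm_eq_integral_norm, ← integral_const_mul]
    refine (integral_mono_ae (hint n (hL1 u)).norm ((hL1 u).norm.const_mul |C|) ?_).trans
      (setIntegral_le_integral ((L1.integrable_coeFn u).norm.const_mul |C|)
        (ae_of_all _ fun x => by positivity))
    filter_upwards [hb n] with x hx
    rw [norm_mul]
    gcongr
    exact hx.trans (le_abs_self C)
  let e₁ : ℤ → Lp ℂ 1 ell := fun m => ContinuousMap.toLp (E := ℂ) 1 ell ℂ (fourier m)
  have hdense : (Submodule.span ℂ (Set.range e₁)).topologicalClosure = ⊤ :=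
    span_fourierLp_closure_eq_top (T := 2 * π) (p := 1) (by norm_num)
  have key := tendsto_zero_of_span_dense φ hφ hdense (by
    rintro _ ⟨m, rfl⟩
    have e : ∀ n, φ n (e₁ m) = fourierCoeff (d n) (-m) -
        ∫ x in I, fourier m x * d n x ∂ell := by
      intro n
      have hmi : Integrable (fun t => fourier m t * d n t) ell := (hd n).fourier_smul m
      have e1 : φ n (e₁ m) = ∫ x in Iᶜ, fourier m x * d n x ∂ell := by
        refine integral_congr_ae (ae_restrict_of_ae ?_)
        filter_upwards [ContinuousMap.coeFn_toLp (p := 1) (𝕜 := ℂ) ell (fourier m)] with x hx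
        rw [hx, mul_comm]
      rw [e1, fourierCoeff_eq_integral, neg_neg, ← integral_add_compl hIm hmi]
      ring
    simp only [e]
    have h2 : Tendsto (fun n => ∫ x in I, fourier m x * d n x ∂ell) atTop (𝓝 0) := by
      refine squeeze_zero_norm (fun n => ?_) hI
      refine (norm_integral_le_integral_norm _).trans_eq ?_
      simp only [norm_mul, norm_fourier_apply, one_mul]
    simpa using (hc (-m)).sub h2)
  have hhi : Integrable (Iᶜ.indicator h) ell := (integrable_indicator_iff hIm.compl).2 hh
  refine (key (hhi.toL1 _)).congr fun n => ?_
  refine integral_congr_ae ?_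
  filter_upwards [ae_restrict_of_ae (Integrable.coeFn_toL1 hhi), ae_restrict_mem hIm.compl]
    with x hx hxI
  rw [hx, Set.indicator_of_mem hxI]

/-! ### Penalized projections in a Hilbert space -/

section Hilbert

variable {E : Type*} [NormedAddCommGroup E] [InnerProductSpace ℝ E] [CompleteSpace E]

/-- The penalized problem: minimize `‖c - b‖² + s² ‖P c‖²` over a closed convex set. -/
lemma exists_penalized_minimizer {K : Set E} (hK : Convex ℝ K) (hKc : IsClosed K)
    (hKn : K.Nonempty) (P : E →L[ℝ] E) (b : E) (s : ℝ) :
    ∃ c ∈ K, ∀ c' ∈ K,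
      inner ℝ (b - c) (c' - c) - s ^ 2 * inner ℝ (P c) (P (c' - c)) ≤ 0 := by
  -- The penalized functional is the squared distance from `(b, 0)` to `A c`, so its minimizer is a
  -- projection onto the convex set `A '' K`, complete because `A` is bounded below.
  let A : E →ₗ[ℝ] WithLp 2 (E × E) :=
    { toFun := fun c => WithLp.toLp 2 (c, s • P c)
      map_add' := fun x y => by
        rw [← WithLp.toLp_add]; simp
      map_smul' := fun a x => by
        rw [← WithLp.toLp_smul]; simp [smul_comm s a] }
  have hAc : Continuous A := by
    change Continuous fun c => WithLp.toLp 2 (c, s • P c)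
    exact (WithLp.prod_continuous_toLp 2 E E).comp (by fun_prop)
  have hAn : ∀ x, ‖x‖ ≤ ‖A x‖ := fun x => by
    have h : ‖A x‖ ^ 2 = ‖x‖ ^ 2 + ‖s • P x‖ ^ 2 := WithLp.prod_norm_sq_eq_of_L2 _
    exact abs_le_of_sq_le_sq' (by nlinarith [sq_nonneg ‖s • P x‖]) (norm_nonneg _) |>.2
  have hcomp : IsComplete (A '' K) := by
    have hanti : AntilipschitzWith 1 A :=
      AddMonoidHomClass.antilipschitz_of_bound A (by simpa using hAn)
    have huc : UniformContinuous A :=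
      (⟨A, hAc⟩ : E →L[ℝ] WithLp 2 (E × E)).uniformContinuous
    exact (isComplete_image_iff (hanti.isUniformInducing huc)).2 hKc.isComplete
  have hconv : Convex ℝ (A '' K) := hK.linear_image A
  obtain ⟨_, ⟨c, hc, rfl⟩, hmin⟩ := exists_norm_eq_iInf_of_complete_convex (hKn.image A) hcomp hconv
    (WithLp.toLp 2 (b, 0))
  refine ⟨c, hc, fun c' hc' => ?_⟩
  have h := (norm_eq_iInf_iff_real_inner_le_zero hconv ⟨c, hc, rfl⟩).1 hmin (A c') ⟨c', hc', rfl⟩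
  rw [← map_sub, WithLp.prod_inner_apply] at h
  have e : inner ℝ (b - c) (c' - c) + inner ℝ (0 - s • P c) (s • P (c' - c)) ≤ 0 := h
  rw [zero_sub, inner_neg_left, real_inner_smul_left, real_inner_smul_right] at e
  linarith

/-- A nearest point of `K ∩ H` to `b` is a limit of points `c n` of `K` for which `b - c n` is the
sum of a vector orthogonal to `H` and a vector in the normal cone of `K`. -/
theorem exists_approximate_multipliers {K : Set E} (hK : Convex ℝ K) (hKc : IsClosed K)
    (H : Submodule ℝ E) (hH : IsClosed (H : Set E)) {b g : E} (hgK : g ∈ K) (hgH : g ∈ H)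
    (hmin : ∀ x ∈ K, x ∈ H → ‖b - g‖ ≤ ‖b - x‖) :
    ∃ c r : ℕ → E, (∀ n, c n ∈ K) ∧ (∀ n, r n ∈ Hᗮ) ∧ Tendsto c atTop (𝓝 g) ∧
      (∀ n, 0 ≤ inner ℝ (r n) (c n)) ∧
      ∀ n, ∀ c' ∈ K, inner ℝ (b - c n - r n) (c' - c n) ≤ 0 := by
  let P : E →L[ℝ] E := Hᗮ.starProjection
  have hPP : ∀ x y, inner ℝ (P x) (P y) = inner ℝ (P x) y := fun x y => by
    have h1 : P (P x) = P x := by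
      have := Submodule.isIdempotentElem_starProjection Hᗮ
      exact congrArg (fun T : E →L[ℝ] E => T x) this
    have h2 := Submodule.inner_starProjection_left_eq_right Hᗮ (P x) y
    rw [← h2]
    exact congrArg (fun z => inner ℝ z y) h1
  have hP0 : ∀ x, P x = 0 ↔ x ∈ H := fun x => by
    change Hᗮ.starProjection x = 0 ↔ x ∈ H
    rw [Submodule.starProjection_apply_eq_zero_iff, Submodule.orthogonal_orthogonal_eq_closure,
      hH.submodule_topologicalClosure_eq]
  choose c hcK hc using fun n : ℕ => exists_penalized_minimizer hK hKc ⟨g, hgK⟩ P b (n : ℝ)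
  let Φ : ℕ → E → ℝ := fun n x => ‖b - x‖ ^ 2 + (n : ℝ) ^ 2 * ‖P x‖ ^ 2
  -- Strong convexity: both squares are expanded at `c n`, and the variational inequality disposes
  -- of the linear terms.
  have hstrong : ∀ n, ∀ x ∈ K, Φ n (c n) + ‖x - c n‖ ^ 2 ≤ Φ n x := by
    intro n x hx
    have h := hc n x hx
    have e1 : ‖b - x‖ ^ 2 = ‖b - c n‖ ^ 2 - 2 * inner ℝ (b - c n) (x - c n) + ‖x - c n‖ ^ 2 := by
      rw [← norm_sub_sq_real, sub_sub_sub_cancel_right]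
    have e2 : ‖P x‖ ^ 2 = ‖P (c n)‖ ^ 2 + 2 * inner ℝ (P (c n)) (P (x - c n))
        + ‖P (x - c n)‖ ^ 2 := by
      rw [← norm_add_sq_real, ← map_add, add_sub_cancel]
    simp only [Φ, e1, e2]
    nlinarith [mul_nonneg (sq_nonneg (n : ℝ)) (sq_nonneg ‖P (x - c n)‖)]
  let v : ℕ → ℝ := fun n => Φ n (c n)
  have hstep : ∀ {n m : ℕ}, n ≤ m → v n + ‖c m - c n‖ ^ 2 ≤ v m := by
    intro n m hnm
    refine (hstrong n (c m) (hcK m)).trans ?_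
    simp only [v, Φ]
    have : (n : ℝ) ≤ m := by exact_mod_cast hnm
    gcongr
  have hPg : P g = 0 := (hP0 g).2 hgH
  have hvg : ∀ n, v n + ‖g - c n‖ ^ 2 ≤ ‖b - g‖ ^ 2 := by
    intro n
    have := hstrong n g hgK
    simpa [Φ, hPg] using this
  -- The minimal values increase with the penalty and are bounded by the value at `g`; their gaps
  -- dominate `‖c m - c n‖ ^ 2`, so `c` is Cauchy.
  have hmono : Monotone v := fun n m hnm => by nlinarith [hstep hnm, sq_nonneg ‖c m - c n‖]
  have hbdd : BddAbove (Set.range v) := ⟨‖b - g‖ ^ 2, by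
    rintro _ ⟨n, rfl⟩; nlinarith [hvg n, sq_nonneg ‖g - c n‖]⟩
  have hvlim := tendsto_atTop_ciSup hmono hbdd
  have hcauchy : CauchySeq c := by
    rw [Metric.cauchySeq_iff']
    intro ε hε
    obtain ⟨N, hN⟩ := Metric.cauchySeq_iff'.1 hvlim.cauchySeq (ε ^ 2) (by positivity)
    refine ⟨N, fun n hn => ?_⟩
    have h1 := hN n hn
    have h2 := hstep hn
    rw [Real.dist_eq] at h1
    have h3 := lt_of_le_of_lt (le_abs_self _) h1
    rw [dist_eq_norm]
    exact lt_of_pow_lt_pow_left₀ 2 hε.le (by linarith)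
  obtain ⟨l, hl⟩ := cauchySeq_tendsto_of_complete hcauchy
  have hlK : l ∈ K := hKc.mem_of_tendsto hl (Eventually.of_forall hcK)
  have hPl : P l = 0 := by
    have h1 : Tendsto (fun n => ‖P (c n)‖) atTop (𝓝 ‖P l‖) := ((P.continuous.tendsto l).comp hl).norm
    have h2 : Tendsto (fun n : ℕ => ‖b - g‖ * (1 / (n : ℝ))) atTop (𝓝 0) := by
      simpa using tendsto_one_div_atTop_nhds_zero_nat.const_mul ‖b - g‖
    have h3 : ‖P l‖ ≤ 0 := by
      refine le_of_tendsto_of_tendsto h1 h2 ?_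
      filter_upwards [eventually_gt_atTop 0] with n hn
      have hn' : (0 : ℝ) < n := by exact_mod_cast hn
      rw [mul_one_div, le_div_iff₀ hn']
      have h4 := hvg n
      simp only [v, Φ] at h4
      refine abs_le_of_sq_le_sq' ?_ (norm_nonneg _) |>.2
      nlinarith [sq_nonneg ‖g - c n‖, sq_nonneg ‖b - c n‖]
    exact norm_le_zero_iff.1 h3
  -- The limit is admissible, so `‖b - g‖ ≤ ‖b - l‖`; passing to the limit in `hvg` leaves no room
  -- for `‖g - l‖`.
  have hlg : l = g := by
    have h1 : Tendsto (fun n => ‖b - c n‖ ^ 2 + ‖g - c n‖ ^ 2) atTop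
        (𝓝 (‖b - l‖ ^ 2 + ‖g - l‖ ^ 2)) :=
      ((hl.const_sub b).norm.pow 2).add ((hl.const_sub g).norm.pow 2)
    have h2 : ‖b - l‖ ^ 2 + ‖g - l‖ ^ 2 ≤ ‖b - g‖ ^ 2 := by
      refine le_of_tendsto' h1 fun n => ?_
      have h4 := hvg n
      simp only [v, Φ] at h4
      nlinarith [mul_nonneg (sq_nonneg (n : ℝ)) (sq_nonneg ‖P (c n)‖)]
    have h3 := hmin l hlK ((hP0 l).1 hPl)
    have h5 : ‖g - l‖ ^ 2 ≤ 0 := by nlinarith [norm_nonneg (b - g)]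
    have h6 : ‖g - l‖ = 0 := by nlinarith [norm_nonneg (g - l)]
    exact (sub_eq_zero.1 (norm_eq_zero.1 h6)).symm
  -- The multiplier is the gradient at `c n` of the penalty `x ↦ n² ‖P x‖² / 2`.
  refine ⟨c, fun n => ((n : ℝ) ^ 2) • P (c n), hcK, fun n => ?_, hlg ▸ hl, fun n => ?_,
    fun n c' hc' => ?_⟩
  · exact Submodule.smul_mem _ _ (Submodule.starProjection_apply_mem _ _)
  · rw [real_inner_smul_left, ← hPP]
    exact mul_nonneg (sq_nonneg _) real_inner_self_nonneg
  · have := hc n c' hc'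
    rw [inner_sub_left, real_inner_smul_left, ← hPP]
    exact this

end Hilbert

/-! ### Saturation of the constraint -/

lemma real_inner_Lp_eq_integral (u v : Lp ℂ 2 ell) :
    inner ℝ u v = ∫ x, ((starRingEnd ℂ) (u x) * v x).re ∂ell := by
  rw [L2.inner_def]
  simp only [Complex.inner, mul_comm]

lemma integrable_re_conj_mul {u v : UnitTorus → ℂ} (hu : MemLp u 2 ell) (hv : MemLp v 2 ell) :
    Integrable (fun x => ((starRingEnd ℂ) (u x) * v x).re) ell := by
  have h : MemLp (fun x => (starRingEnd ℂ) (u x)) 2 ell := hu.star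
  have := (memLp_one_iff_integrable.1 (hv.mul h (r := 1))).re
  exact this

/-- The elements of `L²` of the circle that are bounded by one on `J`. -/
def boundedOn (J : Set UnitTorus) : Set (Lp ℂ 2 ell) :=
  {c | ∀ᵐ x ∂(ell.restrict J), ‖(c : UnitTorus → ℂ) x‖ ≤ 1}

lemma convex_boundedOn (J : Set UnitTorus) : Convex ℝ (boundedOn J) := by
  intro u hu v hv a b ha hb hab
  have e := ae_restrict_of_ae (s := J) (Lp.coeFn_add (a • u) (b • v))
  have e1 := ae_restrict_of_ae (s := J) (Lp.coeFn_smul a u)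
  have e2 := ae_restrict_of_ae (s := J) (Lp.coeFn_smul b v)
  filter_upwards [hu, hv, e, e1, e2] with x h1 h2 h3 h4 h5
  rw [h3, Pi.add_apply, h4, h5, Pi.smul_apply, Pi.smul_apply]
  refine (norm_add_le _ _).trans ?_
  rw [norm_smul, norm_smul, Real.norm_of_nonneg ha, Real.norm_of_nonneg hb]
  nlinarith

lemma isClosed_boundedOn (J : Set UnitTorus) : IsClosed (boundedOn J) := by
  refine IsSeqClosed.isClosed fun c l hc hl => ?_
  obtain ⟨φ, -, hφ⟩ := (tendstoInMeasure_of_tendsto_Lp hl).exists_seq_tendsto_ae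
  have h : ∀ᵐ x ∂(ell.restrict J), ∀ n, ‖(c n : UnitTorus → ℂ) x‖ ≤ 1 := ae_all_iff.2 hc
  filter_upwards [h, ae_restrict_of_ae hφ] with x h1 h2
  exact le_of_tendsto' h2.norm fun n => h1 _

/-- The Hardy space `H²` as a real subspace of `L²` of the circle. -/
noncomputable def hardySubmodule : Submodule ℝ (Lp ℂ 2 ell) where
  carrier := {c | ∀ n : ℤ, n < 0 → ellBasis.repr c n = 0}
  add_mem' := fun {u v} hu hv n hn => by
    rw [map_add, lp.coeFn_add, Pi.add_apply, hu n hn, hv n hn, add_zero]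
  zero_mem' := fun n _ => by rw [map_zero]; rfl
  smul_mem' := fun a u hu n hn => by
    have e : a • u = (a : ℂ) • u := (Complex.coe_smul a u).symm
    rw [e, map_smul, lp.coeFn_smul, Pi.smul_apply, hu n hn, smul_zero]

lemma mem_hardySubmodule {c : Lp ℂ 2 ell} : c ∈ hardySubmodule ↔ MemHardy 2 c := by
  refine ⟨fun h => ⟨Lp.memLp c, fun n hn => ?_⟩, fun h n hn => ?_⟩
  · rw [← ellBasis_repr]; exact h n hn
  · rw [ellBasis_repr]; exact h.2 n hn

lemma isClosed_hardySubmodule : IsClosed (hardySubmodule : Set (Lp ℂ 2 ell)) := by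
  have e : (hardySubmodule : Set (Lp ℂ 2 ell)) =
      ⋂ (n : ℤ) (_ : n < 0), {c | inner ℂ (ellBasis n) c = 0} := by
    ext c
    simp only [Set.mem_iInter, Set.mem_ofPred_eq, ← ellBasis.repr_apply_apply]
    rfl
  rw [e]
  exact isClosed_iInter fun n => isClosed_iInter fun _ =>
    isClosed_eq (by fun_prop) continuous_const

/-- Orthogonality is for the real inner product, so each test controls only a real part; the
monomial is multiplied by `a = 1` and `a = i` to reach the whole coefficient. -/
lemma fourierCoeff_eq_zero_of_mem_orthogonal {r : Lp ℂ 2 ell} (hr : r ∈ hardySubmoduleᗮ) {n : ℤ}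
    (hn : 0 ≤ n) : fourierCoeff (r : UnitTorus → ℂ) n = 0 := by
  have hm : ∀ a : ℂ, (a * fourierCoeff (r : UnitTorus → ℂ) n).re = 0 := by
    intro a
    have mp : MemHardy 2 fun x => (starRingEnd ℂ) a * polyTrace (Polynomial.X ^ n.toNat) x :=
      (memHardy_polyTrace _ 2).const_mul _
    have hmem : mp.1.toLp _ ∈ hardySubmodule := mem_hardySubmodule.2
      ⟨Lp.memLp _, fun m hm => by
        rw [fourierCoeff_congr_ell mp.1.coeFn_toLp]; exact mp.2 m hm⟩
    have h := (Submodule.mem_orthogonal _ _).1 hr _ hmem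
    rw [real_inner_Lp_eq_integral] at h
    have hri : Integrable (fun x => a * (fourier (-n) x * (r : UnitTorus → ℂ) x)) ell :=
      (((Lp.memLp r).integrable (by norm_num)).fourier_smul (-n)).const_mul a
    have e2 : a * fourierCoeff (r : UnitTorus → ℂ) n
        = ∫ x, a * (fourier (-n) x * (r : UnitTorus → ℂ) x) ∂ell := by
      rw [fourierCoeff_eq_integral, integral_const_mul]
    have e3 : (∫ x, a * (fourier (-n) x * (r : UnitTorus → ℂ) x) ∂ell).re
        = ∫ x, (a * (fourier (-n) x * (r : UnitTorus → ℂ) x)).re ∂ell := (integral_re hri).symm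
    rw [e2, e3, ← h]
    refine integral_congr_ae ?_
    filter_upwards [mp.1.coeFn_toLp] with x hx
    rw [hx]
    simp only [polyTrace, Polynomial.eval_pow, Polynomial.eval_X, fourier_one_pow,
      Int.toNat_of_nonneg hn, map_mul, Complex.conj_conj, fourier_neg]
    rw [mul_assoc]
  apply Complex.ext
  · simpa using hm 1
  · simpa using hm Complex.I

/-- The unimodular factor of a complex number, `0` at `0`. -/
noncomputable def unimodular (z : ℂ) : ℂ := z / ‖z‖

lemma norm_unimodular_le (z : ℂ) : ‖unimodular z‖ ≤ 1 := by
  rw [unimodular, norm_div, Complex.norm_real, norm_norm]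
  exact div_self_le_one _

lemma conj_mul_unimodular (z : ℂ) : (starRingEnd ℂ) z * unimodular z = ‖z‖ := by
  by_cases hz : z = 0
  · simp [hz, unimodular]
  · have : (‖z‖ : ℂ) ≠ 0 := by simpa using hz
    rw [unimodular, mul_div_assoc', div_eq_iff this, Complex.conj_mul', sq]

lemma measurable_unimodular : Measurable unimodular := by
  unfold unimodular; fun_prop

/-- Testing a vector of the normal cone of `boundedOn Iᶜ` at `c`. -/
lemma ae_eq_zero_and_setIntegral_le_of_normal {I : Set UnitTorus} (hIm : MeasurableSet I)
    {u c : Lp ℂ 2 ell} (hc : c ∈ boundedOn Iᶜ)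
    (h : ∀ c' ∈ boundedOn Iᶜ, inner ℝ u (c' - c) ≤ 0) :
    (∀ᵐ x ∂ell, x ∈ I → (u : UnitTorus → ℂ) x = 0) ∧
      ∀ v : UnitTorus → ℂ, AEStronglyMeasurable v ell →
        (∀ᵐ x ∂(ell.restrict Iᶜ), ‖v x‖ ≤ 1) →
        ∫ x in Iᶜ, ((starRingEnd ℂ) ((u : UnitTorus → ℂ) x) * v x).re ∂ell ≤ inner ℝ u c := by
  have hu0 : ∀ᵐ x ∂ell, x ∈ I → (u : UnitTorus → ℂ) x = 0 := by
    -- Nothing is constrained on `I`: adding `u` there to `c` is allowed, and the test yields that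
    -- `∫_I |u|²` is at most zero.
    have m1 : MemLp (I.indicator (u : UnitTorus → ℂ)) 2 ell := (Lp.memLp u).indicator hIm
    have h1 := h (c + m1.toLp _) (by
      filter_upwards [hc, ae_restrict_of_ae (Lp.coeFn_add c (m1.toLp _)),
        ae_restrict_of_ae m1.coeFn_toLp, ae_restrict_mem hIm.compl] with x a1 a2 a3 a4
      rw [a2, Pi.add_apply, a3, Set.indicator_of_notMem a4, add_zero]
      exact a1)
    rw [add_sub_cancel_left, real_inner_Lp_eq_integral] at h1
    have e : ∀ᵐ x ∂ell, ((starRingEnd ℂ) ((u : UnitTorus → ℂ) x) *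
        (m1.toLp _ : UnitTorus → ℂ) x).re = ‖I.indicator (u : UnitTorus → ℂ) x‖ ^ 2 := by
      filter_upwards [m1.coeFn_toLp] with x hx
      rw [hx]
      by_cases hxI : x ∈ I
      · rw [Set.indicator_of_mem hxI, Complex.conj_mul']
        norm_cast
      · simp [hxI]
    rw [integral_congr_ae e] at h1
    have h2 := (integral_eq_zero_iff_of_nonneg (fun _ => by positivity)
      (m1.integrable_norm_pow (by norm_num))).1 (le_antisymm h1 (integral_nonneg fun _ => by positivity))
    filter_upwards [h2] with x hx hxI
    simpa [hxI] using hx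
  refine ⟨hu0, fun v hv hvb => ?_⟩
  -- The competitor equals `v` on `Iᶜ` and `c` on `I`, where `u` already vanishes.
  have m1 : MemLp (Iᶜ.indicator v + I.indicator (c : UnitTorus → ℂ)) 2 ell := by
    refine MemLp.add ((memLp_indicator_iff_restrict hIm.compl).2 ?_) ((Lp.memLp c).indicator hIm)
    exact MemLp.of_bound hv.restrict 1 hvb
  have h1 := h (m1.toLp _) (by
    filter_upwards [hvb, ae_restrict_of_ae m1.coeFn_toLp, ae_restrict_mem hIm.compl] with x a1 a2 a3
    have a4 : x ∉ I := a3
    rw [a2, Pi.add_apply, Set.indicator_of_mem a3, Set.indicator_of_notMem a4, add_zero]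
    exact a1)
  rw [inner_sub_right, sub_nonpos] at h1
  refine le_trans (le_of_eq ?_) h1
  rw [real_inner_Lp_eq_integral, ← integral_indicator hIm.compl]
  refine integral_congr_ae ?_
  filter_upwards [hu0, m1.coeFn_toLp] with x a1 a2
  by_cases hxI : x ∈ I
  · have : x ∉ Iᶜ := fun h => h hxI
    rw [Set.indicator_of_notMem this, a1 hxI]; simp
  · rw [Set.indicator_of_mem (show x ∈ Iᶜ from hxI), a2, Pi.add_apply,
      Set.indicator_of_mem (show x ∈ Iᶜ from hxI), Set.indicator_of_notMem hxI, add_zero]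

lemma integral_norm_le_norm_Lp (u : Lp ℂ 2 ell) (E : Set UnitTorus) :
    ∫ x in E, ‖(u : UnitTorus → ℂ) x‖ ∂ell ≤ ‖u‖ := by
  refine (integral_norm_le_lpNormOn E ((Lp.memLp u).restrict E)).trans ?_
  rw [Lp.norm_def]
  exact ENNReal.toReal_mono (Lp.memLp u).2.ne (eLpNorm_mono_measure _ Measure.restrict_le_self)

lemma exists_pos_measure_norm_le {J : Set UnitTorus} {g : UnitTorus → ℂ}
    (hg : Measurable g) (hb : BoundedByOneOn J g)
    (hns : ¬ ∀ᵐ x ∂(ell.restrict J), ‖g x‖ = 1) :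
    ∃ η > 0, 0 < ell ({x | ‖g x‖ ≤ 1 - η} ∩ J) := by
  by_contra! hcon
  apply hns
  have h : ∀ n : ℕ, ∀ᵐ x ∂(ell.restrict J), 1 - 1 / ((n : ℝ) + 1) < ‖g x‖ := by
    intro n
    have h0 := hcon (1 / ((n : ℝ) + 1)) (by positivity)
    rw [ae_iff]
    simp only [not_lt]
    rw [Measure.restrict_apply (measurableSet_le hg.norm measurable_const)]
    exact le_antisymm h0 zero_le
  filter_upwards [ae_all_iff.2 h, hb] with x h1 h2
  refine le_antisymm h2 ?_
  have ht : Tendsto (fun n : ℕ => 1 - 1 / ((n : ℝ) + 1)) atTop (𝓝 1) := by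
    simpa using tendsto_one_div_add_atTop_nhds_zero_nat.const_sub (1 : ℝ)
  exact le_of_tendsto' ht fun n => (h1 n).le

lemma tendsto_integral_mul_continuous {r : ℕ → UnitTorus → ℂ} (hr : ∀ n, Integrable (r n) ell)
    {M : ℝ} (hM : ∀ n, ∫ x, ‖r n x‖ ∂ell ≤ M)
    (hc : ∀ m, Tendsto (fun n => fourierCoeff (r n) m) atTop (𝓝 0)) (χ : C(UnitTorus, ℂ)) :
    Tendsto (fun n => ∫ x, r n x * χ x ∂ell) atTop (𝓝 0) := by
  have hint : ∀ n (u : C(UnitTorus, ℂ)), Integrable (fun x => r n x * u x) ell := fun n u =>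
    (hr n).mul_bdd (c := ‖u‖) u.continuous.aestronglyMeasurable
      (ae_of_all _ fun x => u.norm_coe_le_norm x)
  let φ : ℕ → C(UnitTorus, ℂ) →ₗ[ℂ] ℂ := fun n =>
    { toFun := fun u => ∫ x, r n x * u x ∂ell
      map_add' := fun u v => by
        rw [← integral_add (hint n u) (hint n v)]
        simp only [ContinuousMap.add_apply, mul_add]
      map_smul' := fun c u => by
        rw [RingHom.id_apply, smul_eq_mul, ← integral_const_mul]
        simp only [ContinuousMap.smul_apply, smul_eq_mul, mul_left_comm] }
  refine tendsto_zero_of_span_dense φ (C := M) (fun n u => ?_)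
    (span_fourier_closure_eq_top (T := 2 * π)) ?_ χ
  · refine (norm_integral_le_integral_norm _).trans ?_
    refine le_trans ?_ (mul_le_mul_of_nonneg_right (hM n) (norm_nonneg u))
    rw [← integral_mul_const]
    refine integral_mono (hint n u).norm ((hr n).norm.mul_const _) fun x => ?_
    simp only [norm_mul]
    gcongr
    exact u.norm_coe_le_norm x
  · rintro _ ⟨m, rfl⟩
    refine (hc (-m)).congr fun n => ?_
    rw [fourierCoeff_eq_integral, neg_neg]
    simp only [φ, LinearMap.coe_mk, AddHom.coe_mk, mul_comm]

/-- The distance to `Iᶜ` vanishes off `I` and is positive on the interior of `I`. The product of `ψ`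
with it has all its Fourier coefficients zero, each being a test against an allowed function. -/
lemma ae_eq_zero_of_integral_mul_continuous {I : Set UnitTorus}
    (hI0 : ell (I \ interior I) = 0) (hJ : Iᶜ.Nonempty) {ψ : UnitTorus → ℂ} (hψ : MemLp ψ 2 ell)
    (h : ∀ χ : C(UnitTorus, ℂ), (∀ x ∉ I, χ x = 0) → ∫ x, ψ x * χ x ∂ell = 0) :
    ∀ᵐ x ∂ell, x ∈ I → ψ x = 0 := by
  have hcont : Continuous fun x : UnitTorus => (Metric.infDist x Iᶜ : ℂ) :=
    Complex.continuous_ofReal.comp (Metric.continuous_infDist_pt _)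
  let κ : C(UnitTorus, ℂ) := ⟨_, hcont⟩
  have m1 : MemLp (fun x => ψ x * κ x) 2 ell := by
    refine hψ.of_le_mul (c := ‖κ‖) (hψ.1.mul hcont.aestronglyMeasurable) (ae_of_all _ fun x => ?_)
    rw [norm_mul, mul_comm]
    gcongr
    exact κ.norm_coe_le_norm x
  have h0 := ae_eq_zero_of_fourierCoeff_eq_zero m1 fun n => by
    have := h (κ * fourier (-n)) fun x hx => by
      have : Metric.infDist x Iᶜ = 0 := Metric.infDist_zero_of_mem hx
      simp [κ, this]
    rw [fourierCoeff_eq_integral, ← this]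
    congr 1; ext x
    rw [ContinuousMap.mul_apply]; ring
  have h1 : ∀ᵐ x ∂ell, x ∉ I \ interior I := measure_eq_zero_iff_ae_notMem.1 hI0
  filter_upwards [h0, h1] with x a1 a2 hxI
  have hxi : x ∈ interior I := by_contra fun hh => a2 ⟨hxI, hh⟩
  have hpos : Metric.infDist x Iᶜ ≠ 0 := by
    intro hz
    have := (Metric.mem_closure_iff_infDist_zero hJ).2 hz
    rw [closure_compl] at this
    exact this hxi
  have a3 : ψ x * (Metric.infDist x Iᶜ : ℂ) = 0 := a1
  rcases mul_eq_zero.1 a3 with h | h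
  · exact h
  · exact absurd (by exact_mod_cast h) hpos

/-- If the solution of the bounded extremal problem does not saturate the constraint, then it
interpolates the data. -/
theorem ae_eq_of_not_saturated {I : Set UnitTorus} (hIc : IsClosed I)
    (hI0 : ell (I \ interior I) = 0) {f g₀ : UnitTorus → ℂ} (hf : MemLpOn 2 I f)
    (hg₀ : IsBEPSolution I f g₀) (hns : ¬ ∀ᵐ x ∂(ell.restrict Iᶜ), ‖g₀ x‖ = 1) :
    ∀ᵐ x ∂(ell.restrict I), f x = g₀ x := by
  obtain ⟨hgH, hgb, hmin⟩ := hg₀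
  have hIm := hIc.measurableSet
  have mB : MemLp (I.indicator f + Iᶜ.indicator g₀) 2 ell :=
    ((memLp_indicator_iff_restrict hIm).2 hf).add (hgH.1.indicator hIm.compl)
  let B : Lp ℂ 2 ell := mB.toLp _
  let G : Lp ℂ 2 ell := hgH.1.toLp g₀
  have eG : (G : UnitTorus → ℂ) =ᵐ[ell] g₀ := hgH.1.coeFn_toLp
  have eB : (B : UnitTorus → ℂ) =ᵐ[ell] I.indicator f + Iᶜ.indicator g₀ := mB.coeFn_toLp
  have hGK : G ∈ boundedOn Iᶜ := by
    filter_upwards [hgb, ae_restrict_of_ae eG] with x h1 h2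
    rw [h2]; exact h1
  have hGH : G ∈ hardySubmodule := mem_hardySubmodule.2 ⟨Lp.memLp G, fun n hn => by
    rw [fourierCoeff_congr_ell eG]; exact hgH.2 n hn⟩
  -- Since `B` equals `g₀` on `Iᶜ`, the distance from `B` to `G` is carried by `I`, while that to
  -- any other `x` is at least its part on `I`; minimality on `I` becomes minimality on the circle.
  have hnear : ∀ x ∈ boundedOn Iᶜ, x ∈ hardySubmodule → ‖B - G‖ ≤ ‖B - x‖ := by
    intro c hcK hcH
    rw [Lp.norm_def, Lp.norm_def]
    refine ENNReal.toReal_mono (Lp.memLp (B - c)).2.ne ?_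
    have e1 : eLpNorm ((B - G : Lp ℂ 2 ell) : UnitTorus → ℂ) 2 ell
        = lpNormOn 2 I fun x => f x - g₀ x := by
      rw [lpNormOn, ← eLpNorm_indicator_eq_eLpNorm_restrict hIm]
      refine eLpNorm_congr_ae ?_
      filter_upwards [Lp.coeFn_sub B G, eB, eG] with x a1 a2 a3
      rw [a1, Pi.sub_apply, a2, a3, Pi.add_apply]
      by_cases hxI : x ∈ I
      · have : x ∉ Iᶜ := fun h => h hxI
        simp [hxI]
      · simp [hxI]
    have e2 : (lpNormOn 2 I fun x => f x - (c : UnitTorus → ℂ) x)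
        ≤ eLpNorm ((B - c : Lp ℂ 2 ell) : UnitTorus → ℂ) 2 ell := by
      rw [lpNormOn, ← eLpNorm_indicator_eq_eLpNorm_restrict hIm]
      refine eLpNorm_mono_ae ?_
      filter_upwards [Lp.coeFn_sub B c, eB] with x a1 a2
      by_cases hxI : x ∈ I
      · rw [a1, Pi.sub_apply, a2, Pi.add_apply]
        simp [hxI]
      · simp [hxI]
    rw [e1]
    exact (hmin _ (mem_hardySubmodule.1 hcH) hcK).trans e2
  obtain ⟨c, r, hcK, hrH, hct, hrc, hnor⟩ := exists_approximate_multipliers (convex_boundedOn Iᶜ)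
    (isClosed_boundedOn Iᶜ) hardySubmodule isClosed_hardySubmodule hGK hGH hnear
  let u : ℕ → Lp ℂ 2 ell := fun n => B - c n - r n
  have hur : ∀ n, r n = B - c n - u n := fun n => by simp only [u]; abel
  have hu := fun n => ae_eq_zero_and_setIntegral_le_of_normal hIm (u := u n) (hcK n) (hnor n)
  -- This is where the sign `0 ≤ ⟨r n, c n⟩` enters: it bounds the pairing, and hence the `L¹` norm
  -- of `u n`, without any bound on `r n`.
  have huc : ∀ n, inner ℝ (u n) (c n) ≤ inner ℝ (B - c n) (c n) := fun n => by
    simp only [u]; rw [inner_sub_left (B - c n)]; linarith [hrc n]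
  have hui : ∀ n, Integrable (u n : UnitTorus → ℂ) ell := fun n =>
    (Lp.memLp (u n)).integrable (by norm_num)
  have hri : ∀ n, Integrable (r n : UnitTorus → ℂ) ell := fun n =>
    (Lp.memLp (r n)).integrable (by norm_num)
  have msgn : ∀ n, AEStronglyMeasurable (fun x => unimodular ((u n : UnitTorus → ℂ) x)) ell :=
    fun n => (measurable_unimodular.comp (Lp.stronglyMeasurable (u n)).measurable).aestronglyMeasurable
  -- the multipliers are bounded in `L¹`
  have huL1 : ∀ n, ∫ x in Iᶜ, ‖(u n : UnitTorus → ℂ) x‖ ∂ell ≤ inner ℝ (u n) (c n) := by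
    intro n
    have := (hu n).2 _ (msgn n) (ae_of_all _ fun x => norm_unimodular_le _)
    simpa only [conj_mul_unimodular, Complex.ofReal_re] using this
  have huI : ∀ n, ∫ x in I, ‖(u n : UnitTorus → ℂ) x‖ ∂ell = 0 := by
    intro n
    have : ∀ᵐ x ∂(ell.restrict I), ‖(u n : UnitTorus → ℂ) x‖ = 0 := by
      rw [ae_restrict_iff' hIm]
      filter_upwards [(hu n).1] with x hx hxI
      rw [hx hxI, norm_zero]
    rw [integral_congr_ae this, integral_zero]
  have hrle : ∀ n (E : Set UnitTorus), ∫ x in E, ‖(r n : UnitTorus → ℂ) x‖ ∂ell ≤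
      ∫ x in E, ‖((B - c n : Lp ℂ 2 ell) : UnitTorus → ℂ) x‖ ∂ell +
        ∫ x in E, ‖(u n : UnitTorus → ℂ) x‖ ∂ell := by
    intro n E
    have hbi : Integrable ((B - c n : Lp ℂ 2 ell) : UnitTorus → ℂ) ell :=
      (Lp.memLp _).integrable (by norm_num)
    rw [← integral_add hbi.norm.integrableOn (hui n).norm.integrableOn]
    refine integral_mono_ae (hri n).norm.integrableOn
      (hbi.norm.integrableOn.add (hui n).norm.integrableOn) (ae_restrict_of_ae ?_)
    filter_upwards [Lp.coeFn_sub (B - c n) (u n)] with x hx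
    have : (r n : UnitTorus → ℂ) x = ((B - c n - u n : Lp ℂ 2 ell) : UnitTorus → ℂ) x := by
      rw [← hur n]
    simp only [this, hx, Pi.sub_apply]
    exact norm_sub_le _ _
  have hBc : Tendsto (fun n => ‖B - c n‖ + ‖B - c n‖ * ‖c n‖) atTop
      (𝓝 (‖B - G‖ + ‖B - G‖ * ‖G‖)) :=
    (hct.const_sub B).norm.add ((hct.const_sub B).norm.mul hct.norm)
  obtain ⟨M, hM⟩ := hBc.bddAbove_range
  have hrM : ∀ n, ∫ x, ‖(r n : UnitTorus → ℂ) x‖ ∂ell ≤ M := by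
    intro n
    have h1 := hrle n Set.univ
    have h2 := integral_norm_le_norm_Lp (B - c n) Set.univ
    rw [Measure.restrict_univ] at h1 h2
    have h3 : ∫ x, ‖(u n : UnitTorus → ℂ) x‖ ∂ell ≤ ‖B - c n‖ * ‖c n‖ := by
      rw [← integral_add_compl hIm (hui n).norm, huI, zero_add]
      exact (huL1 n).trans ((huc n).trans (real_inner_le_norm _ _))
    linarith [hM ⟨n, rfl⟩]
  -- the multipliers tend to zero in `L¹` where the constraint is not saturated
  obtain ⟨η, hη, hEpos⟩ := exists_pos_measure_norm_le
    (Lp.stronglyMeasurable G).measurable hGK (fun h => hns (by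
      filter_upwards [h, ae_restrict_of_ae eG] with x h1 h2
      rw [← h2]; exact h1))
  set E : Set UnitTorus := {x | ‖(G : UnitTorus → ℂ) x‖ ≤ 1 - η} ∩ Iᶜ with hE
  have hEm : MeasurableSet E :=
    (measurableSet_le (Lp.stronglyMeasurable G).measurable.norm measurable_const).inter hIm.compl
  have huE : ∀ n, η * ∫ x in E, ‖(u n : UnitTorus → ℂ) x‖ ∂ell ≤ ‖B - c n‖ * ‖c n - G‖ := by
    intro n
    -- On `E` there is room `η` below the constraint, so `G` may be pushed by `η` in the direction
    -- of `u n`. This gains `η * ∫_E |u n|`, while `r n ⟂ G` bounds the gain by `⟨B - c n, c n -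
    -- G⟩`.
    let v : UnitTorus → ℂ := fun x => (G : UnitTorus → ℂ) x +
      E.indicator (fun x => (η : ℂ) * unimodular ((u n : UnitTorus → ℂ) x)) x
    have hvm : AEStronglyMeasurable v ell := (Lp.aestronglyMeasurable G).add
      ((aestronglyMeasurable_const.mul (msgn n)).indicator hEm)
    have h1 := (hu n).2 v hvm (by
      filter_upwards [hGK] with x hx
      by_cases hxE : x ∈ E
      · simp only [v, Set.indicator_of_mem hxE]
        have h2 : ‖(η : ℂ) * unimodular ((u n : UnitTorus → ℂ) x)‖ ≤ η := by
          rw [norm_mul, Complex.norm_real, Real.norm_of_nonneg hη.le]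
          exact mul_le_of_le_one_right hη.le (norm_unimodular_le _)
        have h3 : ‖(G : UnitTorus → ℂ) x‖ ≤ 1 - η := hxE.1
        exact (norm_add_le _ _).trans (by linarith)
      · simp only [v, Set.indicator_of_notMem hxE, add_zero]
        exact hx)
    have h2 : ∫ x in Iᶜ, ((starRingEnd ℂ) ((u n : UnitTorus → ℂ) x) * v x).re ∂ell
        = inner ℝ (u n) G + η * ∫ x in E, ‖(u n : UnitTorus → ℂ) x‖ ∂ell := by
      rw [real_inner_Lp_eq_integral, ← integral_indicator hEm, ← integral_const_mul,
        ← integral_indicator hIm.compl, ← integral_add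
          (integrable_re_conj_mul (Lp.memLp _) (Lp.memLp _))
          (((hui n).norm.indicator hEm).const_mul _)]
      refine integral_congr_ae ?_
      filter_upwards [(hu n).1] with x hx
      by_cases hxI : x ∈ I
      · have h3 : x ∉ Iᶜ := fun h => h hxI
        have h4 : x ∉ E := fun h => h.2 hxI
        rw [Set.indicator_of_notMem h3, Set.indicator_of_notMem h4, hx hxI]
        simp
      · rw [Set.indicator_of_mem (show x ∈ Iᶜ from hxI)]
        by_cases hxE : x ∈ E
        · simp only [v, Set.indicator_of_mem hxE]
          rw [mul_add, Complex.add_re, mul_left_comm, conj_mul_unimodular, ← Complex.ofReal_mul,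
            Complex.ofReal_re]
        · simp only [v, Set.indicator_of_notMem hxE, add_zero, mul_zero]
    have h3 : inner ℝ (r n) G = 0 := by
      rw [real_inner_comm]; exact (Submodule.mem_orthogonal _ _).1 (hrH n) G hGH
    have h4 : inner ℝ (u n) (c n) - inner ℝ (u n) G ≤ inner ℝ (B - c n) (c n - G) := by
      rw [← inner_sub_right]
      simp only [u]
      rw [inner_sub_left (B - c n), inner_sub_right (r n), h3]
      linarith [hrc n]
    have h5 := real_inner_le_norm (B - c n) (c n - G)
    linarith
  have hrE : Tendsto (fun n => ∫ x in E, ‖(r n : UnitTorus → ℂ) x‖ ∂ell) atTop (𝓝 0) := by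
    have hup : Tendsto (fun n => ‖G - c n‖ + ‖B - c n‖ * ‖c n - G‖ / η) atTop (𝓝 0) := by
      have h1 : Tendsto (fun n => ‖G - c n‖) atTop (𝓝 0) := by
        simpa using (hct.const_sub G).norm
      have h2 : Tendsto (fun n => ‖c n - G‖) atTop (𝓝 0) := by
        simpa using (hct.sub_const G).norm
      simpa using h1.add (((hct.const_sub B).norm.mul h2).div_const η)
    refine squeeze_zero (fun n => integral_nonneg fun _ => norm_nonneg _) (fun n => ?_) hup
    refine (hrle n E).trans (add_le_add ?_ ?_)
    -- On `E ⊆ Iᶜ` the functions `B` and `G` coincide, so this term tends to zero.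
    · refine le_trans (le_of_eq (integral_congr_ae ?_)) (integral_norm_le_norm_Lp (G - c n) E)
      filter_upwards [ae_restrict_mem hEm, ae_restrict_of_ae (Lp.coeFn_sub B (c n)),
        ae_restrict_of_ae (Lp.coeFn_sub G (c n)), ae_restrict_of_ae eB, ae_restrict_of_ae eG]
        with x a1 a2 a3 a4 a5
      have a6 : x ∉ I := a1.2
      have a7 : x ∈ Iᶜ := a1.2
      simp only [a2, a3, Pi.sub_apply, a4, a5, Pi.add_apply, Set.indicator_of_notMem a6,
        Set.indicator_of_mem a7, zero_add]
    · rw [le_div_iff₀ hη, mul_comm]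
      exact huE n
  -- hence their Fourier coefficients tend to zero
  have hd : ∀ n, MemHardy 2 fun x => (starRingEnd ℂ) ((r n : UnitTorus → ℂ) x) := fun n =>
    ⟨(Lp.memLp (r n)).star, fun m hm => by
      rw [fourierCoeff_conj, fourierCoeff_eq_zero_of_mem_orthogonal (hrH n) (by omega), map_zero]⟩
  have hcoef : ∀ m, Tendsto (fun n => fourierCoeff (r n : UnitTorus → ℂ) m) atTop (𝓝 0) := by
    intro m
    have h1 := tendsto_fourierCoeff_of_tendsto_zero_on hEm hEpos hd (M := M)
      (by simpa using hrM) (by simpa using hrE) (-m)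
    have h2 := (Complex.continuous_conj.tendsto 0).comp h1
    simpa [Function.comp_def, fourierCoeff_conj] using h2
  have mψ : MemLp (B - G : Lp ℂ 2 ell) 2 ell := Lp.memLp (B - G)
  have hJne : Iᶜ.Nonempty := by
    by_contra h
    rw [Set.not_nonempty_iff_eq_empty] at h
    rw [hE, h, Set.inter_empty, measure_empty] at hEpos
    exact lt_irrefl _ hEpos
  have hψ0 := ae_eq_zero_of_integral_mul_continuous hI0 hJne mψ (by
    intro χ hχ
    have h1 := tendsto_integral_mul_continuous hri hrM hcoef χ
    have hbd : ∀ (w : Lp ℂ 2 ell), Integrable (fun x => (w : UnitTorus → ℂ) x * χ x) ell :=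
      fun w => ((Lp.memLp w).integrable (by norm_num)).mul_bdd (c := ‖χ‖)
        χ.continuous.aestronglyMeasurable (ae_of_all _ fun x => χ.norm_coe_le_norm x)
    -- The test function lives on `I`, where `u n` vanishes, so `r n` may be replaced by `B - c n`;
    -- in the limit only `B - G` remains.
    have e1 : ∀ n, ∫ x, (r n : UnitTorus → ℂ) x * χ x ∂ell =
        ∫ x, ((B - G : Lp ℂ 2 ell) : UnitTorus → ℂ) x * χ x ∂ell +
          ∫ x, ((G - c n : Lp ℂ 2 ell) : UnitTorus → ℂ) x * χ x ∂ell := by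
      intro n
      rw [← integral_add (hbd _) (hbd _)]
      refine integral_congr_ae ?_
      have hrn : B - G + (G - c n) - u n = r n := by rw [hur n]; abel
      filter_upwards [(hu n).1, Lp.coeFn_sub (B - G + (G - c n)) (u n),
        Lp.coeFn_add (B - G) (G - c n)] with x a1 a2 a3
      rw [hrn] at a2
      by_cases hxI : x ∈ I
      · rw [a2, Pi.sub_apply, a3, Pi.add_apply, a1 hxI, sub_zero, add_mul]
      · rw [hχ x hxI]; simp
    have h2 : Tendsto (fun n => ∫ x, ((G - c n : Lp ℂ 2 ell) : UnitTorus → ℂ) x * χ x ∂ell)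
        atTop (𝓝 0) := by
      have hup : Tendsto (fun n => ‖G - c n‖ * ‖χ‖) atTop (𝓝 0) := by
        simpa using (hct.const_sub G).norm.mul_const ‖χ‖
      refine squeeze_zero_norm (fun n => ?_) hup
      refine (norm_integral_le_integral_norm _).trans ?_
      have h3 := integral_norm_le_norm_Lp (G - c n) Set.univ
      rw [Measure.restrict_univ] at h3
      refine le_trans ?_ (mul_le_mul_of_nonneg_right h3 (norm_nonneg χ))
      rw [← integral_mul_const]
      refine integral_mono (hbd _).norm
        (((Lp.memLp (G - c n)).integrable (by norm_num)).norm.mul_const _) fun x => ?_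
      simp only [norm_mul]
      gcongr
      exact χ.norm_coe_le_norm x
    simp only [e1] at h1
    have h4 := h2.const_add (∫ x, ((B - G : Lp ℂ 2 ell) : UnitTorus → ℂ) x * χ x ∂ell)
    rw [add_zero] at h4
    exact tendsto_nhds_unique h4 h1)
  rw [ae_restrict_iff' hIm]
  filter_upwards [hψ0, Lp.coeFn_sub B G, eB, eG] with x a1 a2 a3 a4 hxI
  have h1 := a1 hxI
  have h2 : x ∉ Iᶜ := fun h => h hxI
  rw [a2, Pi.sub_apply, a3, a4, Pi.add_apply, Set.indicator_of_mem hxI,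
    Set.indicator_of_notMem h2, add_zero] at h1
  exact sub_eq_zero.1 h1

/-! ### Convergence of the polynomial solutions -/

/-- If `|g| = 1` and `|k| ≤ 1`, then `|g - k|² ≤ 2 Re ((g - k) * conj g)`, so weak convergence
tested against `g` gives convergence in `L²(J)`. The uniform bound `|g - k| ≤ 2` then gives every
finite exponent. -/
lemma tendsto_lpNormOn_of_saturated {J : Set UnitTorus} {g : UnitTorus → ℂ} (hg : MemLp g 2 ell)
    (hg1 : ∀ᵐ x ∂(ell.restrict J), ‖g x‖ = 1) {k : ℕ → UnitTorus → ℂ}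
    (hk : ∀ n, MemLp (k n) 2 ell) (hkb : ∀ n, BoundedByOneOn J (k n))
    (hweak : ∀ h : UnitTorus → ℂ, Integrable h (ell.restrict J) →
      Tendsto (fun n => ∫ x in J, (g x - k n x) * h x ∂ell) atTop (𝓝 0))
    {p : ℝ≥0∞} (hp : 1 ≤ p) (hp' : p ≠ ⊤) :
    Tendsto (fun n => lpNormOn p J fun x => g x - k n x) atTop (𝓝 0) := by
  have hd : ∀ n, MemLp (fun x => g x - k n x) 2 (ell.restrict J) := fun n =>
    (hg.sub (hk n)).restrict J
  have hgc : MemLp (fun x => (starRingEnd ℂ) (g x)) 2 (ell.restrict J) := (hg.restrict J).star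
  have hw := hweak _ (hgc.integrable (by norm_num))
  have hsq : ∀ n, ∫ x in J, ‖g x - k n x‖ ^ 2 ∂ell ≤
      2 * (∫ x in J, (g x - k n x) * (starRingEnd ℂ) (g x) ∂ell).re := by
    intro n
    have hi : Integrable (fun x => (g x - k n x) * (starRingEnd ℂ) (g x)) (ell.restrict J) :=
      memLp_one_iff_integrable.1 (hgc.mul (hd n) (r := 1))
    have e : (∫ x in J, (g x - k n x) * (starRingEnd ℂ) (g x) ∂ell).re
        = ∫ x in J, ((g x - k n x) * (starRingEnd ℂ) (g x)).re ∂ell := (integral_re hi).symm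
    rw [e, ← integral_const_mul]
    refine integral_mono_ae ((hd n).integrable_norm_pow (by norm_num)) (hi.re.const_mul 2) ?_
    filter_upwards [hg1, hkb n] with x h1 h2
    have h3 : ‖g x‖ ^ 2 = 1 := by rw [h1]; norm_num
    have h4 : ‖k n x‖ ^ 2 ≤ 1 := pow_le_one₀ (norm_nonneg _) h2
    rw [← Complex.normSq_eq_norm_sq, Complex.normSq_apply] at h3 h4 ⊢
    simp only [Complex.sub_re, Complex.sub_im, Complex.mul_re, Complex.conj_re, Complex.conj_im]
    nlinarith
  have hlim : Tendsto (fun n => ∫ x in J, ‖g x - k n x‖ ^ 2 ∂ell) atTop (𝓝 0) := by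
    have hup : Tendsto (fun n => 2 * (∫ x in J, (g x - k n x) * (starRingEnd ℂ) (g x) ∂ell).re)
        atTop (𝓝 0) := by
      have := ((Complex.continuous_re.tendsto 0).comp hw).const_mul 2
      simpa [Function.comp_def] using this
    exact squeeze_zero (fun n => integral_nonneg fun _ => by positivity) hsq hup
  have h2 : Tendsto (fun n => eLpNorm (fun x => g x - k n x) 2 (ell.restrict J)) atTop (𝓝 0) := by
    rw [← ENNReal.tendsto_toReal_iff (fun n => (hd n).2.ne) ENNReal.zero_ne_top]
    have := hlim.sqrt
    refine (by simpa using this : Tendsto _ _ (𝓝 (0 : ℝ))).congr fun n => ?_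
    rw [← toReal_eLpNorm_two_sq (hd n)]
    exact Real.sqrt_sq ENNReal.toReal_nonneg
  refine tendsto_eLpNorm_zero_of_dominated_of_tendstoInMeasure hp hp' (fun n => (hd n).1)
    (memLp_const (2 : ℝ)) (fun n => ?_) (tendstoInMeasure_of_tendsto_eLpNorm (p := 2)
      (by norm_num) (fun n => (hd n).1) aestronglyMeasurable_const (h2.congr fun n => ?_))
  · filter_upwards [hg1, hkb n] with x h1 h2
    exact (norm_sub_le _ _).trans (by linarith)
  · congr 1; ext x; simp

end BoundedExtremal

/-! ### Proof of the theorem. -/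

theorem mainTheorem9
    (I : Set UnitTorus) (hI : BoundedExtremal.IsFiniteUnionOfClosedArcs I)
    (hIpos : 0 < BoundedExtremal.ell I) (hJpos : 0 < BoundedExtremal.ell Iᶜ)
    (f : UnitTorus → ℂ) (hf : BoundedExtremal.MemLpOn 2 I f)
    (g₀ : UnitTorus → ℂ) (hg₀ : BoundedExtremal.IsBEPSolution I f g₀)
    (k : ℕ → Polynomial ℂ) (hk : ∀ n, BoundedExtremal.IsFBEPSolution I f n (k n)) :
    -- for every `f`: convergence in `L²(I)` and weak-* convergence in `L^∞(J)`
    (Tendsto (fun n => BoundedExtremal.lpNormOn 2 I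
        (fun x => g₀ x - BoundedExtremal.polyTrace (k n) x)) atTop (𝓝 0) ∧
      ∀ h : UnitTorus → ℂ, BoundedExtremal.MemLpOn 1 Iᶜ h →
        Tendsto (fun n => BoundedExtremal.pairingOn Iᶜ (BoundedExtremal.polyTrace (k n)) h) atTop
          (𝓝 (BoundedExtremal.pairingOn Iᶜ g₀ h))) ∧
    -- norm convergence, unless `f` is the trace of an admissible function that does not
    -- saturate the constraint
    ((∀ g : UnitTorus → ℂ, BoundedExtremal.MemHardy 2 g → BoundedExtremal.BoundedByOneOn Iᶜ g →
        (∀ᵐ x ∂(BoundedExtremal.ell.restrict I), f x = g x) →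
        ∀ᵐ x ∂(BoundedExtremal.ell.restrict Iᶜ), ‖g x‖ = 1) →
      Tendsto (fun n => BoundedExtremal.lpNormOn 2 Set.univ
        (fun x => g₀ x - BoundedExtremal.polyTrace (k n) x)) atTop (𝓝 0) ∧
      ∀ p : ℝ≥0∞, 1 ≤ p → p ≠ ⊤ →
        Tendsto (fun n => BoundedExtremal.lpNormOn p Iᶜ
          (fun x => g₀ x - BoundedExtremal.polyTrace (k n) x)) atTop (𝓝 0)) := by
  have hIc := hI.isClosed
  have hIm := hIc.measurableSet
  have hA := BoundedExtremal.tendsto_lpNormOn_of_isFBEPSolution hIm hI.measure_closure_compl_diff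
    hf hg₀ hk
  have hd : ∀ n, BoundedExtremal.MemHardy 2
      fun x => g₀ x - BoundedExtremal.polyTrace (k n) x := fun n =>
    hg₀.1.sub (BoundedExtremal.memHardy_polyTrace (k n) 2)
  have hdi := fun n => (hd n).1.integrable (q := 2) (by norm_num)
  have hb : ∀ n, ∀ᵐ x ∂(BoundedExtremal.ell.restrict Iᶜ),
      ‖g₀ x - BoundedExtremal.polyTrace (k n) x‖ ≤ 2 := fun n => by
    filter_upwards [hg₀.2.1, (hk n).2.1] with x h1 h2
    exact (norm_sub_le _ _).trans (by linarith)
  have hI1 : Tendsto (fun n => ∫ x in I, ‖g₀ x - BoundedExtremal.polyTrace (k n) x‖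
      ∂BoundedExtremal.ell) atTop (𝓝 0) := by
    have hup := (ENNReal.tendsto_toReal ENNReal.zero_ne_top).comp hA
    exact squeeze_zero (fun n => integral_nonneg fun _ => norm_nonneg _)
      (fun n => BoundedExtremal.integral_norm_le_lpNormOn I ((hd n).1.restrict I)) hup
  obtain ⟨M, hM⟩ := hI1.bddAbove_range
  -- `M` bounds the part on `I`; on `Iᶜ` both functions have modulus at most one, whence the `2`.
  have hM' : ∀ n, ∫ x, ‖g₀ x - BoundedExtremal.polyTrace (k n) x‖ ∂BoundedExtremal.ell
      ≤ M + 2 := by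
    intro n
    rw [← integral_add_compl hIm (hdi n).norm]
    refine add_le_add (hM ⟨n, rfl⟩) ?_
    refine (integral_mono_ae (hdi n).norm.integrableOn (integrable_const 2) (hb n)).trans ?_
    rw [integral_const, smul_eq_mul]
    have : (BoundedExtremal.ell.restrict Iᶜ).real Set.univ ≤ 1 := by
      rw [measureReal_restrict_apply_univ]; exact measureReal_le_one
    linarith
  have hcoef := BoundedExtremal.tendsto_fourierCoeff_of_tendsto_zero_on hIm hIpos hd hM' hI1
  have hweak : ∀ h : UnitTorus → ℂ, Integrable h (BoundedExtremal.ell.restrict Iᶜ) →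
      Tendsto (fun n => ∫ x in Iᶜ, (g₀ x - BoundedExtremal.polyTrace (k n) x) * h x
        ∂BoundedExtremal.ell) atTop (𝓝 0) := fun h hh =>
    BoundedExtremal.tendsto_setIntegral_compl_mul hIm hdi hb hI1 hcoef hh
  refine ⟨⟨hA, fun h hh => ?_⟩, fun hsat => ?_⟩
  · have hhc : Integrable (fun x => (starRingEnd ℂ) (h x)) (BoundedExtremal.ell.restrict Iᶜ) :=
      memLp_one_iff_integrable.1 hh.star
    have h1 := (hweak _ hhc).const_sub (BoundedExtremal.pairingOn Iᶜ g₀ h)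
    rw [sub_zero] at h1
    refine h1.congr fun n => ?_
    have i1 : Integrable (fun x => g₀ x * (starRingEnd ℂ) (h x))
        (BoundedExtremal.ell.restrict Iᶜ) := hhc.bdd_mul hg₀.1.1.1.restrict hg₀.2.1
    have i2 : Integrable (fun x => BoundedExtremal.polyTrace (k n) x * (starRingEnd ℂ) (h x))
        (BoundedExtremal.ell.restrict Iᶜ) :=
      hhc.bdd_mul (BoundedExtremal.memHardy_polyTrace (k n) 2).1.1.restrict (hk n).2.1
    simp only [BoundedExtremal.pairingOn, sub_mul]
    rw [integral_sub i1 i2, sub_sub_cancel]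
  · have hone : ∀ᵐ x ∂(BoundedExtremal.ell.restrict Iᶜ), ‖g₀ x‖ = 1 := by
      -- An unsaturated `g₀` interpolates `f` on `I`, so the hypothesis applies to `g₀` itself and
      -- forces saturation.
      by_contra hns
      exact hns (hsat g₀ hg₀.1 hg₀.2.1 (BoundedExtremal.ae_eq_of_not_saturated hIc
        hI.measure_diff_interior hf hg₀ hns))
    have hJ := fun {p : ℝ≥0∞} (hp : 1 ≤ p) (hp' : p ≠ ⊤) =>
      BoundedExtremal.tendsto_lpNormOn_of_saturated (J := Iᶜ) hg₀.1.1 hone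
        (fun n => (BoundedExtremal.memHardy_polyTrace (k n) 2).1) (fun n => (hk n).2.1)
        hweak hp hp'
    refine ⟨?_, fun p hp hp' => hJ hp hp'⟩
    have hsum := hA.add (hJ (p := 2) (by norm_num) (by norm_num))
    rw [add_zero] at hsum
    refine tendsto_of_tendsto_of_tendsto_of_le_of_le tendsto_const_nhds hsum (fun _ => zero_le)
      fun n => ?_
    simp only [BoundedExtremal.lpNormOn, Measure.restrict_univ]
    rw [← eLpNorm_indicator_eq_eLpNorm_restrict hIm,
      ← eLpNorm_indicator_eq_eLpNorm_restrict hIm.compl]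
    refine le_trans (le_of_eq ?_) (eLpNorm_add_le ((hd n).1.1.indicator hIm)
      ((hd n).1.1.indicator hIm.compl) (by norm_num))
    rw [Set.indicator_self_add_compl]
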